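/- **Setting.** Let $X, X_1,X_2,\dots$ be i.i.d. random variables with values in a measurable space $\mathcal X$ and distribution $P_0$, and let $K\ge 1$ be the number of candidate models. Model $k\in\{1,\dots,K\}$ has a complexity $c(k)\in[0,\infty)$, an open parameter set $\Theta_k\subseteq\mathbb R^{d_k}$, a measurable loss $\ell_k:\mathcal X\times\Theta_k\to\mathbb R$, a minimizer $\theta_k^*\in\arg\min_{\theta\in\Theta_k}\mathbb E\,\ell_k(X;\theta)$, and a measurable estimator $\hat\theta_k=\hat\theta_k(X_1,\dots,X_n)\in\Theta_k$. Put $\mu^0=(\mathbb E\,\ell_k(X;\theta_k^*))_{k}\in\mathbb R^K$ and $\Sigma^0=\mathrm{Cov}\big((\ell_k(X;\theta_k^*))_{k}\big)$. Assume: 1. $\mathbb E\,\ell_k(X;\theta^*_k)^2<\infty$ for every $k$, and $\Sigma^0$ is positive definite. 2. For every $k$ there is $r>0$ such that the open ball $B_r(\theta^*_k)$ is contained in $\Theta_k$ and (a) $\mathbb E|\ell_k(X;\theta)|<\infty$ for all $\theta\in B_r(\theta_k^*)$; (b) $\theta\mapsto\ell_k(x;\theta)$ is twice continuously differentiable on $B_r(\theta_k^*)$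 for every $x\in\mathcal X$; (c) there is $H:\mathcal X\to[0,\infty)$ with $\mathbb E\,H(X)<\infty$ and $\sup_{\theta\in B_r(\theta_k^*)}\|\nabla^2_\theta\ell_k(x;\theta)\|\le H(x)$ (Frobenius norm) for every $x$; (d) $\mathbb E\|\nabla_\theta\ell_k(X;\theta_k^*)\|^2<\infty$; (e) $\|\hat\theta_k-\theta_k^*\|=O_p(1/\sqrt n)$. For $\mu\in\mathbb R^K$ and $\delta>0$ let $M_\delta(\mu)=\{k:\mu_k\le\min_j\mu_j+\delta\}$, $c_\delta^*(\mu)=\min\{c(k):k\in M_\delta(\mu)\}$ and $$M_\delta^*(\mu)=\arg\min_{k:\,c(k)=c^*_\delta(\mu)}\mu_k .$$ Assume $\delta\ne\mu^0_k-\min_j\mu^0_j$ for all $k$, and let $\alpha_n\ge0$ satisfy $\alpha_n\to\infty$ and $\alpha_n=o(\sqrt n)$. Put $r_{nk}(\mu)=\exp\big(-\alpha_n(\mu_k-\min_{j:\,c(j)=c(k)}\mu_j)\big)$. Let $Z_i=(\ell_k(X_i;\hat\theta_k))_{k}\in\mathbb R^K$ for $i=1,\dots,n$, $\bar Z_n=\frac1n\sum_i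 Z_i$ and $S_n=\frac1n\sum_i(Z_i-\bar Z_n)(Z_i-\bar Z_n)^{\mathsf T}$. Fix $\mu_0\in\mathbb R^K$, $\lambda_0>0$, $\nu_0>K-1$ and a positive definite $\Psi_0\in\mathbb R^{K\times K}$. Let $\mathrm{NIW}(\mu_0,\lambda_0,\Psi_0,\nu_0)$ be the normal-inverse-Wishart distribution of $(\mu,\Sigma)$, with density $\mathcal N(\mu\mid\mu_0,\Sigma/\lambda_0)\,\mathrm{InverseWishart}(\Sigma\mid\Psi_0,\nu_0)$. With this prior, the posterior of $(\mu,\Sigma)$ given $Z_{1:n}$ in the working model $Z_1,\dots,Z_n\mid\mu,\Sigma\sim\mathcal N(\mu,\Sigma)$ i.i.d. is $\mathrm{NIW}(\mu_n,\lambda_n,\Psi_n,\nu_n)$ with $\lambda_n=\lambda_0+n$, $\mu_n=(\lambda_0\mu_0+n\bar Z_n)/\lambda_n$, $\Psi_n=\Psi_0+nS_n+(\lambda_0n/\lambda_n)(\bar Z_n-\mu_0)(\bar Z_n-\mu_0)^{\mathsf T}$ and $\nu_n=\nu_0+n$. Define, under this posterior, $$w_\delta(k\mid Z_{1:n})=P\big(c_\delta^*(\mu)=c(k)\mid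 Z_{1:n}\big)\;\mathbb E\big(r_{nk}(\mu)\mid Z_{1:n}\big).$$ For a fixed $T\ge1$ let $\mu^{(1)},\dots,\mu^{(T)}$ be random vectors (depending on $n$), each of which has this posterior of $\mu$ as its conditional distribution given $Z_{1:n}$, and define $$\hat w_\delta(k)=\Big(\frac1T\sum_{t=1}^T\mathbf 1\big(c_\delta^*(\mu^{(t)})=c(k)\big)\Big)\Big(\frac1T\sum_{t=1}^Tr_{nk}(\mu^{(t)})\Big).$$ **Theorem.** For every fixed $\omega\in(0,1)$, as $n\to\infty$, $$P\big(\{k:w_\delta(k\mid Z_{1:n})>\omega\}=M^*_\delta(\mu^0)\big)\to1\qquad\text{and}\qquad P\big(\{k:\hat w_\delta(k)>\omega\}=M^*_\delta(\mu^0)\big)\to1 .$$ -/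

import Mathlib

open MeasureTheory ProbabilityTheory Filter Topology Asymptotics
open scoped NNReal ENNReal Matrix

namespace LaD

noncomputable section

/-! ### The target set of models -/

/-- The set `M_δ(μ)` of `δ`-optimal models: `μ_k ≤ min_j μ_j + δ`. -/
def deltaOptimal {K : ℕ} (δ : ℝ) (μ : Fin K → ℝ) : Set (Fin K) :=
  {k | μ k ≤ (⨅ j, μ j) + δ}

/-- The minimal complexity `c*_δ(μ)` among the `δ`-optimal models. -/
def minComplexity {K : ℕ} (δ : ℝ) (c : Fin K → ℝ≥0) (μ : Fin K → ℝ) : ℝ≥0 :=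
  sInf (c '' deltaOptimal δ μ)

/-- The best minimal-complexity `δ`-optimal models,
`M*_δ(μ) = argmin {μ_k : c(k) = c*_δ(μ)}`. -/
def targetSet {K : ℕ} (δ : ℝ) (c : Fin K → ℝ≥0) (μ : Fin K → ℝ) : Set (Fin K) :=
  {k | c k = minComplexity δ c μ ∧ ∀ j, c j = minComplexity δ c μ → μ k ≤ μ j}

/-- The within-class soft-selection score
`r_{nk}(μ) = exp (-α_n (μ_k - min {μ_j : c(j) = c(k)}))`, at temperature `a = α_n`. -/
def softScore {K : ℕ} (a : ℝ) (c : Fin K → ℝ≥0) (k : Fin K) (μ : Fin K → ℝ) : ℝ :=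
  Real.exp (-a * (μ k - ⨅ j : {j : Fin K // c j = c k}, μ j))

/-! ### The normal-inverse-Wishart distribution -/

/-- Index set of the entries on and above the diagonal of a `K × K` matrix. -/
abbrev UpperIdx (K : ℕ) : Type := {p : Fin K × Fin K // p.1 ≤ p.2}

/-- The symmetric matrix with given entries on and above the diagonal.  Real symmetric `K × K`
matrices are parametrized in this way by `UpperIdx K → ℝ`, and Lebesgue measure on symmetric
matrices is `volume` on `UpperIdx K → ℝ`. -/
def symMatrix {K : ℕ} (v : UpperIdx K → ℝ) : Matrix (Fin K) (Fin K) ℝ :=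
  Matrix.of fun i j => v ⟨(min i j, max i j), min_le_max⟩

/-- Density of the multivariate normal distribution `N(m, S)` at `x`, for positive definite `S`. -/
def gaussianDensity {K : ℕ} (m : Fin K → ℝ) (S : Matrix (Fin K) (Fin K) ℝ) (x : Fin K → ℝ) : ℝ :=
  (Real.sqrt ((2 * Real.pi) ^ K * S.det))⁻¹ *
    Real.exp (-(1 / 2) * ((x - m) ⬝ᵥ (S⁻¹ *ᵥ (x - m))))

open Classical in
/-- Unnormalized density of `InverseWishart(Ψ, ν)`:
`det(Σ)^(-(ν + K + 1)/2) exp(-tr(Ψ Σ⁻¹)/2)` on positive definite `Σ`, and `0` elsewhere. -/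
def invWishartKernel {K : ℕ} (Ψ : Matrix (Fin K) (Fin K) ℝ) (ν : ℝ)
    (S : Matrix (Fin K) (Fin K) ℝ) : ℝ :=
  if S.PosDef then
    S.det ^ (-((ν + K + 1) / 2)) * Real.exp (-(1 / 2) * (Ψ * S⁻¹).trace)
  else 0

/-- Density of `InverseWishart(Ψ, ν)` with respect to Lebesgue measure on symmetric matrices. -/
def invWishartDensity {K : ℕ} (Ψ : Matrix (Fin K) (Fin K) ℝ) (ν : ℝ)
    (S : Matrix (Fin K) (Fin K) ℝ) : ℝ :=
  invWishartKernel Ψ ν S / ∫ v : UpperIdx K → ℝ, invWishartKernel Ψ ν (symMatrix v)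

/-- Hyperparameters `(μ₀, λ₀, Ψ₀, ν₀)` of a normal-inverse-Wishart distribution. -/
structure NIWParams (K : ℕ) where
  /-- the mean `μ₀` -/
  mean : Fin K → ℝ
  /-- the scaling factor `λ₀` -/
  scale : ℝ
  /-- the inverse scale matrix `Ψ₀` -/
  psi : Matrix (Fin K) (Fin K) ℝ
  /-- the degrees of freedom `ν₀` -/
  dof : ℝ

/-- The parameter range of the normal-inverse-Wishart distribution:
`λ₀ > 0`, `Ψ₀` positive definite, `ν₀ > K - 1`. -/
structure NIWParams.Admissible {K : ℕ} (h : NIWParams K) : Prop where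
  scale_pos : 0 < h.scale
  psi_posDef : h.psi.PosDef
  dof_gt : (K : ℝ) - 1 < h.dof

/-- The distribution `NIW(μ₀, λ₀, Ψ₀, ν₀)` of `(μ, Σ)`, with density
`N(μ | μ₀, Σ/λ₀) InverseWishart(Σ | Ψ₀, ν₀)`. -/
def niw {K : ℕ} (h : NIWParams K) : Measure ((Fin K → ℝ) × (UpperIdx K → ℝ)) :=
  volume.withDensity fun p => ENNReal.ofReal
    (gaussianDensity h.mean (h.scale⁻¹ • symMatrix p.2) p.1 *
      invWishartDensity h.psi h.dof (symMatrix p.2))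

/-- The sample mean of `z_1, …, z_n`. -/
def sampleMean {K n : ℕ} (z : Fin n → Fin K → ℝ) : Fin K → ℝ :=
  (n : ℝ)⁻¹ • ∑ i, z i

/-- The sample covariance matrix `n⁻¹ ∑ (z_i - z̄)(z_i - z̄)ᵀ`. -/
def sampleCov {K n : ℕ} (z : Fin n → Fin K → ℝ) : Matrix (Fin K) (Fin K) ℝ :=
  (n : ℝ)⁻¹ • ∑ i, Matrix.vecMulVec (z i - sampleMean z) (z i - sampleMean z)

/-- The parameters `(μ_n, λ_n, Ψ_n, ν_n)` of the posterior given the data `z_1, …, z_n`. -/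
def NIWParams.update {K n : ℕ} (h : NIWParams K) (z : Fin n → Fin K → ℝ) : NIWParams K where
  mean := (h.scale + n)⁻¹ • (h.scale • h.mean + (n : ℝ) • sampleMean z)
  scale := h.scale + n
  psi := h.psi + (n : ℝ) • sampleCov z +
    (h.scale * n / (h.scale + n)) •
      Matrix.vecMulVec (sampleMean z - h.mean) (sampleMean z - h.mean)
  dof := h.dof + n

/-- The posterior distribution of `μ` given `z_1, …, z_n`: the first marginal of the joint
posterior `NIW(μ_n, λ_n, Ψ_n, ν_n)` of `(μ, Σ)`. -/
def lossPosterior {K n : ℕ} (h : NIWParams K) (z : Fin n → Fin K → ℝ) : Measure (Fin K → ℝ) :=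
  (niw (h.update z)).map Prod.fst

/-! ### The smooth LaD criterion score and its Monte Carlo approximation -/

/-- The score `w_δ(k | z_{1:n}) = P(c*_δ(μ) = c(k) | z_{1:n}) E(r_{nk}(μ) | z_{1:n})`. -/
def slcScore {K n : ℕ} (h : NIWParams K) (δ a : ℝ) (c : Fin K → ℝ≥0)
    (z : Fin n → Fin K → ℝ) (k : Fin K) : ℝ :=
  (lossPosterior h z).real {μ | minComplexity δ c μ = c k} * ∫ μ, softScore a c k μ ∂(lossPosterior h z)

open Classical in
/-- The Monte Carlo score `ŵ_δ(k) = p̂_δ(k) r̂(k)` computed from `μ^(1), …, μ^(T)`. -/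
def slcScoreMC {K T : ℕ} (δ a : ℝ) (c : Fin K → ℝ≥0) (m : Fin T → Fin K → ℝ) (k : Fin K) : ℝ :=
  ((T : ℝ)⁻¹ * ∑ t, if minComplexity δ c (m t) = c k then (1 : ℝ) else 0) *
    ((T : ℝ)⁻¹ * ∑ t, softScore a c k (m t))

/-- The estimated target set `{k | w(k) > τ}` of a vector of scores `w`. -/
def selected {K : ℕ} (w : Fin K → ℝ) (τ : ℝ) : Set (Fin K) :=
  {k | τ < w k}

/-! ### Losses, population quantities and regularity conditions -/

/-- `Y_n = O_p(a_n)`. -/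
def IsBigOp {Ω : Type*} [MeasurableSpace Ω] (P : Measure Ω) (Y : ℕ → Ω → ℝ) (a : ℕ → ℝ) : Prop :=
  ∀ ε : ℝ, 0 < ε → ∃ M : ℝ, ∀ᶠ n in atTop, P {ω | M * a n < |Y n ω|} ≤ ENNReal.ofReal ε

/-- The Frobenius norm of the Hessian matrix of `f` at `θ`. -/
def hessianNorm {d : ℕ} (f : EuclideanSpace ℝ (Fin d) → ℝ) (θ : EuclideanSpace ℝ (Fin d)) : ℝ :=
  Real.sqrt (∑ a, ∑ b,
    (fderiv ℝ (fderiv ℝ f) θ (EuclideanSpace.single a 1) (EuclideanSpace.single b 1)) ^ 2)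

variable {𝒳 Ω : Type*} [MeasurableSpace 𝒳] [MeasurableSpace Ω] {K : ℕ} {d : Fin K → ℕ}

/-- `μ⁰_k = E(ℓ_k(X; θ*_k))`, where `X ~ P₀`. -/
def popMean (P₀ : Measure 𝒳) (ℓ : ∀ k, 𝒳 → EuclideanSpace ℝ (Fin (d k)) → ℝ)
    (θs : ∀ k, EuclideanSpace ℝ (Fin (d k))) : Fin K → ℝ :=
  fun k => ∫ x, ℓ k x (θs k) ∂P₀

/-- `Σ⁰ = Cov(ℓ(X; θ*))`, where `X ~ P₀`. -/
def popCov (P₀ : Measure 𝒳) (ℓ : ∀ k, 𝒳 → EuclideanSpace ℝ (Fin (d k)) → ℝ)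
    (θs : ∀ k, EuclideanSpace ℝ (Fin (d k))) : Matrix (Fin K) (Fin K) ℝ :=
  Matrix.of fun j k => covariance (fun x => ℓ j x (θs j)) (fun x => ℓ k x (θs k)) P₀

/-- The LaD vectors `Z_i = (ℓ_k(x_i; θ̂_k(x_1, …, x_n)))_k`, for `i = 1, …, n`. -/
def ladData (ℓ : ∀ k, 𝒳 → EuclideanSpace ℝ (Fin (d k)) → ℝ) {n : ℕ}
    (θhat : ∀ k, (Fin n → 𝒳) → EuclideanSpace ℝ (Fin (d k))) (x : Fin n → 𝒳) :
    Fin n → Fin K → ℝ :=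
  fun i k => ℓ k (x i) (θhat k x)

/-- The first `n` observations. -/
def firstObs (X : ℕ → Ω → 𝒳) (n : ℕ) (ω : Ω) : Fin n → 𝒳 :=
  fun i => X i ω

/-- Moment condition: the optimal losses have finite second moments and a positive definite
covariance matrix. -/
structure MomentCondition (P₀ : Measure 𝒳) (ℓ : ∀ k, 𝒳 → EuclideanSpace ℝ (Fin (d k)) → ℝ)
    (θs : ∀ k, EuclideanSpace ℝ (Fin (d k))) : Prop where
  memLp : ∀ k, MemLp (fun x => ℓ k x (θs k)) 2 P₀
  cov_posDef : (popCov P₀ ℓ θs).PosDef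

/-- Regularity condition for one parametric model with loss `ℓ` on the parameter set `Θ`, a
minimizer `θs` of the expected loss, and the estimators `θhat n = θhat n (X_1, …, X_n)`. -/
structure RegularityCondition {d : ℕ} (P : Measure Ω) (X : ℕ → Ω → 𝒳) (P₀ : Measure 𝒳)
    (Θ : Set (EuclideanSpace ℝ (Fin d))) (ℓ : 𝒳 → EuclideanSpace ℝ (Fin d) → ℝ)
    (θs : EuclideanSpace ℝ (Fin d))
    (θhat : ∀ n, (Fin n → 𝒳) → EuclideanSpace ℝ (Fin d)) : Prop where
  isOpen : IsOpen Θ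
  measurable_loss : Measurable fun p : 𝒳 × Θ => ℓ p.1 p.2
  /-- `θs` minimizes the expected loss over `Θ`.  The comparison is with the `θ` of finite expected
  loss: where the loss is not integrable (for instance of expectation `+∞`), the Bochner integral
  is not the expectation. -/
  isMin : ∀ θ ∈ Θ, Integrable (fun x => ℓ x θ) P₀ → ∫ x, ℓ x θs ∂P₀ ≤ ∫ x, ℓ x θ ∂P₀
  /-- local conditions on a ball around `θs` -/
  local_smooth : ∃ r : ℝ, 0 < r ∧ Metric.ball θs r ⊆ Θ ∧
    (∀ θ ∈ Metric.ball θs r, Integrable (fun x => ℓ x θ) P₀) ∧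
    (∀ x, ContDiffOn ℝ 2 (ℓ x) (Metric.ball θs r)) ∧
    ∃ H : 𝒳 → ℝ, (∀ x, 0 ≤ H x) ∧
      (∀ x, ∀ θ ∈ Metric.ball θs r, hessianNorm (ℓ x) θ ≤ H x) ∧ Integrable H P₀
  gradient_memLp : MemLp (fun x => gradient (ℓ x) θs) 2 P₀
  measurable_estimator : ∀ n, Measurable (θhat n)
  estimator_mem : ∀ n x, θhat n x ∈ Θ
  estimator_rate :
    IsBigOp P (fun n ω => ‖θhat n (firstObs X n ω) - θs‖) (fun n => 1 / Real.sqrt n)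

/-- The random vector `m` is a draw from the posterior given the LaD vectors `Z = (Z_1, …, Z_n)`:
the conditional distribution of `m` given `Z` is the posterior of `μ` given `Z`. -/
def IsPosteriorDraw {n : ℕ} (P : Measure Ω) (h : NIWParams K) (Z : Ω → Fin n → Fin K → ℝ)
    (m : Ω → Fin K → ℝ) : Prop :=
  Measurable m ∧
    ∀ A : Set (Fin n → Fin K → ℝ), MeasurableSet A → ∀ B : Set (Fin K → ℝ), MeasurableSet B →
      P (Z ⁻¹' A ∩ m ⁻¹' B) = ∫⁻ ω in Z ⁻¹' A, lossPosterior h (Z ω) B ∂P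

end

end LaD

open LaD

open LaD

/-! Posterior side. The scores are stable under small perturbations of the mean vector. No gap `μ⁰_k
- min μ⁰` equals `δ`, so the set `M_δ`, and with it `c*_δ`, is constant near `μ⁰`. If every
coordinate moves by at most `s`, the exponent of the soft score moves by at most `2αs`. A model
beaten inside its complexity class by a gap `γ` then scores at most `exp(-α(γ - 2s))`, which
vanishes as `α → ∞`. A minimizer of its class, ties included, keeps at least `exp(-2αs)`. It
therefore suffices that the posterior puts mass close to 1 within distance `s_n` of `μ⁰`, where
`s_n` and `α_n s_n` stay below small constants. The posterior lives at scale `1/√n`, so `√n s_n → ∞`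
is needed, and `α_n = o(√n)` makes these demands compatible (`exists_radius_sequence`). The
deterministic conclusion is `selected_eq_targetSet`.

Concentration is Markov's inequality for `|μ - μ_n|²`. Integrating out the covariance leaves a
multivariate `t` law for `μ` (`map_fst_niw`), whose second moment about its centre is at most a
constant times `tr Ψ_n / (λ_n ν_n)` once `ν_n` is large (`exists_niw_concentration`). Normalizing
constants are never evaluated: the inverse Wishart integral is reduced to `Ψ = 1` by the
substitution `S ↦ A S Aᵀ`, and only its positivity and finiteness matter.

Data side. What remains is that, with high probability, the sample means of the `Z_i` are within
`O(1/√n)` of `μ⁰` and their mean squares are bounded (`exists_sample_moment_bounds`). Near `θ*` the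
loss is Lipschitz with an integrable constant, so plugging in the estimator costs `O_p(1/√n)`;
Markov and Chebyshev control the averages at `θ*`.

For Monte Carlo scores, a draw lands far from `μ⁰` with probability equal to the expected posterior
mass there (`IsPosteriorDraw.measure_le`); a union bound over the `T` draws finishes. -/

namespace LaD

/-! ### The congruence action on symmetric matrices -/

/-- The entries on and above the diagonal of a matrix. -/
def upperEntries {K : ℕ} (S : Matrix (Fin K) (Fin K) ℝ) : UpperIdx K → ℝ := fun p => S p.1.1 p.1.2

lemma symMatrix_apply {K : ℕ} (v : UpperIdx K → ℝ) (i j : Fin K) :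
    symMatrix v i j = v ⟨(min i j, max i j), min_le_max⟩ := rfl

lemma symMatrix_transpose {K : ℕ} (v : UpperIdx K → ℝ) : (symMatrix v)ᵀ = symMatrix v := by
  ext i j
  simp only [Matrix.transpose_apply, symMatrix_apply, min_comm, max_comm]

lemma upperEntries_symMatrix {K : ℕ} (v : UpperIdx K → ℝ) : upperEntries (symMatrix v) = v := by
  ext ⟨⟨i, j⟩, hij⟩
  simp only [upperEntries, symMatrix_apply]
  congr 1
  simp only at hij
  simp [hij]

lemma symMatrix_upperEntries {K : ℕ} {S : Matrix (Fin K) (Fin K) ℝ} (hS : Sᵀ = S) :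
    symMatrix (upperEntries S) = S := by
  ext i j
  simp only [upperEntries, symMatrix_apply]
  rcases le_total i j with h | h
  · simp [h]
  · simp only [h, min_eq_right, max_eq_left]
    rw [← hS, Matrix.transpose_apply, hS]

lemma symMatrix_add {K : ℕ} (v w : UpperIdx K → ℝ) :
    symMatrix (v + w) = symMatrix v + symMatrix w := rfl

lemma symMatrix_smul {K : ℕ} (a : ℝ) (v : UpperIdx K → ℝ) :
    symMatrix (a • v) = a • symMatrix v := rfl

/-- The linear map `S ↦ A S Aᵀ` on symmetric matrices. -/
def congruence {K : ℕ} (A : Matrix (Fin K) (Fin K) ℝ) :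
    (UpperIdx K → ℝ) →ₗ[ℝ] (UpperIdx K → ℝ) where
  toFun v := upperEntries (A * symMatrix v * Aᵀ)
  map_add' v w := by
    rw [symMatrix_add, mul_add, add_mul]; rfl
  map_smul' a v := by
    rw [symMatrix_smul, mul_smul_comm, smul_mul_assoc]; rfl

lemma symMatrix_congruence {K : ℕ} (A : Matrix (Fin K) (Fin K) ℝ) (v : UpperIdx K → ℝ) :
    symMatrix (congruence A v) = A * symMatrix v * Aᵀ := by
  refine symMatrix_upperEntries (S := A * symMatrix v * Aᵀ) ?_
  rw [Matrix.transpose_mul, Matrix.transpose_mul, symMatrix_transpose, Matrix.transpose_transpose,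
    Matrix.mul_assoc]

lemma congruence_mul {K : ℕ} (A B : Matrix (Fin K) (Fin K) ℝ) :
    congruence (A * B) = congruence A ∘ₗ congruence B := by
  refine LinearMap.ext fun v => ?_
  rw [← upperEntries_symMatrix (congruence (A * B) v), symMatrix_congruence, LinearMap.comp_apply,
    ← upperEntries_symMatrix (congruence A _), symMatrix_congruence, symMatrix_congruence,
    Matrix.transpose_mul]
  simp only [Matrix.mul_assoc]

lemma congruence_diagonal_apply {K : ℕ} (D : Fin K → ℝ) (v : UpperIdx K → ℝ) (p : UpperIdx K) :
    congruence (Matrix.diagonal D) v p = D p.1.1 * D p.1.2 * v p := by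
  have h := congrFun (upperEntries_symMatrix v) p
  change (Matrix.diagonal D * symMatrix v * (Matrix.diagonal D)ᵀ) p.1.1 p.1.2 = _
  rw [Matrix.diagonal_transpose, Matrix.mul_diagonal, Matrix.diagonal_mul]
  rw [upperEntries] at h
  rw [h]; ring

lemma prod_upperIdx {K : ℕ} (D : Fin K → ℝ) :
    ∏ p : UpperIdx K, D p.1.1 * D p.1.2 = (∏ i, D i) ^ (K + 1) := by
  have h1 : ∏ p : UpperIdx K, D p.1.1 * D p.1.2 =
      ∏ i, ∏ j, if i ≤ j then D i * D j else 1 := by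
    rw [← Finset.prod_product', Finset.univ_product_univ, ← Finset.prod_filter,
      ← Finset.prod_subtype_eq_prod_filter]
    refine Finset.prod_congr ?_ fun _ _ => rfl
    ext p
    simp
  have h2 : ∀ i j : Fin K, (if i ≤ j then D i * D j else 1) =
      (if i ≤ j then D i else 1) * (if i ≤ j then D j else 1) := by
    intro i j; split_ifs <;> simp
  rw [h1]
  simp_rw [h2, Finset.prod_mul_distrib]
  rw [Finset.prod_comm (f := fun i j => if i ≤ j then D j else 1), ← Finset.prod_mul_distrib,
    ← Finset.prod_pow]
  refine Finset.prod_congr rfl fun i _ => ?_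
  rw [← Finset.prod_filter, ← Finset.prod_filter, Finset.prod_const, Finset.prod_const, ← pow_add]
  congr 1
  -- Index `i` is the smaller entry of `K - i` pairs and the larger entry of `i + 1` pairs, diagonal
  -- included: `K + 1` in total.
  have e1 : Finset.univ.filter (fun j : Fin K => i ≤ j) = Finset.Ici i := by ext; simp
  have e2 : Finset.univ.filter (fun j : Fin K => j ≤ i) = Finset.Iic i := by ext; simp
  rw [e1, e2, Fin.card_Ici, Fin.card_Iic]
  omega

lemma det_congruence_diagonal {K : ℕ} (D : Fin K → ℝ) :
    LinearMap.det (congruence (Matrix.diagonal D)) = (Matrix.diagonal D).det ^ (K + 1) := by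
  have : congruence (Matrix.diagonal D) =
      Matrix.toLin' (Matrix.diagonal fun p : UpperIdx K => D p.1.1 * D p.1.2) := by
    apply LinearMap.ext
    intro v
    funext p
    rw [congruence_diagonal_apply, Matrix.toLin'_apply, Matrix.mulVec_diagonal]
  rw [this, LinearMap.det_toLin', Matrix.det_diagonal, Matrix.det_diagonal, prod_upperIdx]

/-- Conjugation by the diagonal matrix with 2 in place `i` doubles the parameter `t`, and squaring
the transvection doubles it too. The determinant `x` is thus nonzero with `x * x = x`. -/
lemma det_congruence_transvection {K : ℕ} {i j : Fin K} (hij : i ≠ j) (t : ℝ) :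
    LinearMap.det (congruence (Matrix.transvection i j t)) = 1 := by
  have hmul : ∀ A B : Matrix (Fin K) (Fin K) ℝ, LinearMap.det (congruence (A * B)) =
      LinearMap.det (congruence A) * LinearMap.det (congruence B) := fun A B => by
    rw [congruence_mul, LinearMap.det_comp]
  have hone : LinearMap.det (congruence (1 : Matrix (Fin K) (Fin K) ℝ)) = 1 := by
    rw [← Matrix.diagonal_one, det_congruence_diagonal]; simp
  set x := LinearMap.det (congruence (Matrix.transvection i j t)) with hx
  have hsq : LinearMap.det (congruence (Matrix.transvection i j (t + t))) = x * x := by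
    rw [← Matrix.transvection_mul_transvection_same i j hij, hmul]
  have hne : x ≠ 0 := by
    intro h0
    have h := hmul (Matrix.transvection i j t) (Matrix.transvection i j (-t))
    rw [Matrix.transvection_mul_transvection_same i j hij, add_neg_cancel,
      Matrix.transvection_zero, hone, ← hx, h0, zero_mul] at h
    exact one_ne_zero h
  let D : Fin K → ℝ := Function.update 1 i 2
  let E : Fin K → ℝ := Function.update 1 i 2⁻¹
  have hDE : Matrix.diagonal D * Matrix.diagonal E = 1 := by
    rw [Matrix.diagonal_mul_diagonal, ← Matrix.diagonal_one]
    congr 1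
    funext a
    by_cases ha : a = i
    · subst ha; simp [D, E]
    · simp [D, E, ha]
  have hconj : Matrix.diagonal D * Matrix.transvection i j t * Matrix.diagonal E =
      Matrix.transvection i j (t + t) := by
    rw [Matrix.transvection, Matrix.transvection, mul_add, add_mul, mul_one, hDE]
    congr 1
    ext a b
    rw [Matrix.mul_diagonal, Matrix.diagonal_mul, Matrix.single_apply, Matrix.single_apply]
    by_cases h : i = a ∧ j = b
    · obtain ⟨rfl, rfl⟩ := h
      simp [D, E, hij.symm]; ring
    · simp [h]
  have h3 : x * x = x := by
    have h4 := congrArg (fun A => LinearMap.det (congruence A)) hDE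
    simp only [hmul, hone] at h4
    rw [← hsq, ← hconj, hmul, hmul, mul_right_comm, h4, one_mul]
  exact mul_left_cancel₀ hne (by rw [h3, mul_one])

/-- Both sides are multiplicative in `A`, so diagonal matrices and transvections suffice. This is
the Jacobian of `S ↦ A S Aᵀ`. -/
lemma det_congruence {K : ℕ} (A : Matrix (Fin K) (Fin K) ℝ) :
    LinearMap.det (congruence A) = A.det ^ (K + 1) := by
  refine Matrix.diagonal_transvection_induction
    (fun A => LinearMap.det (congruence A) = A.det ^ (K + 1)) A ?_ ?_ ?_
  · exact fun D _ => det_congruence_diagonal D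
  · rintro ⟨i, j, hij, t⟩
    rw [Matrix.TransvectionStruct.toMatrix_mk, det_congruence_transvection hij,
      Matrix.det_transvection_of_ne _ _ hij, one_pow]
  · intro A B hA hB
    rw [congruence_mul, LinearMap.det_comp, hA, hB, Matrix.det_mul, mul_pow]

lemma continuous_symMatrix {K : ℕ} : Continuous (symMatrix (K := K)) :=
  continuous_matrix fun _ _ => continuous_apply _

lemma lintegral_comp_congruence {K : ℕ} {A : Matrix (Fin K) (Fin K) ℝ} (hA : A.det ≠ 0)
    {f : (UpperIdx K → ℝ) → ℝ≥0∞} (hf : Measurable f) :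
    ∫⁻ v, f v = ENNReal.ofReal (|A.det| ^ (K + 1)) * ∫⁻ v, f (congruence A v) := by
  have hdet : LinearMap.det (congruence A) ≠ 0 := by
    rw [det_congruence]; exact pow_ne_zero _ hA
  have hm : Measurable (congruence A) := (LinearMap.continuous_of_finiteDimensional _).measurable
  rw [← lintegral_map hf hm, Measure.map_linearMap_addHaar_eq_smul_addHaar _ hdet,
    lintegral_smul_measure, smul_eq_mul, ← mul_assoc, ← ENNReal.ofReal_mul (by positivity),
    det_congruence, abs_inv, abs_pow, mul_inv_cancel₀ (by positivity), ENNReal.ofReal_one, one_mul]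

/-! ### The normalizing integral of the inverse Wishart distribution -/

open scoped MatrixOrder Matrix.Norms.L2Operator in
lemma exists_eq_mul_transpose {K : ℕ} {S : Matrix (Fin K) (Fin K) ℝ} (hS : S.PosDef) :
    ∃ A : Matrix (Fin K) (Fin K) ℝ, A.det ≠ 0 ∧ S = A * Aᵀ := by
  obtain ⟨B, hB⟩ := CStarAlgebra.nonneg_iff_eq_star_mul_self.mp hS.posSemidef.nonneg
  have hB' : S = Bᵀ * (Bᵀ)ᵀ := by
    rw [hB, Matrix.star_eq_conjTranspose, Matrix.conjTranspose_eq_transpose_of_trivial,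
      Matrix.transpose_transpose]
  refine ⟨Bᵀ, fun h0 => hS.det_pos.ne' ?_, hB'⟩
  rw [hB', Matrix.det_mul, h0, zero_mul]

lemma posDef_congruence_iff {K : ℕ} {A : Matrix (Fin K) (Fin K) ℝ} (hA : A.det ≠ 0)
    (S : Matrix (Fin K) (Fin K) ℝ) : (A * S * Aᵀ).PosDef ↔ S.PosDef := by
  have hu : IsUnit A := (Matrix.isUnit_iff_isUnit_det A).2 hA.isUnit
  rw [← Matrix.IsUnit.posDef_star_right_conjugate_iff hu (x := S), Matrix.star_eq_conjTranspose,
    Matrix.conjTranspose_eq_transpose_of_trivial]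

lemma measurable_det_symMatrix {K : ℕ} : Measurable fun v : UpperIdx K → ℝ => (symMatrix v).det :=
  (continuous_symMatrix.matrix_det).measurable

lemma measurable_inv_symMatrix_apply {K : ℕ} (i j : Fin K) :
    Measurable fun v : UpperIdx K → ℝ => (symMatrix v)⁻¹ i j := by
  have : (fun v : UpperIdx K → ℝ => (symMatrix v)⁻¹ i j) =
      fun v => ((symMatrix v).det)⁻¹ * (symMatrix v).adjugate i j := by
    funext v
    rw [Matrix.inv_def, Matrix.smul_apply, Ring.inverse_eq_inv', smul_eq_mul]
  rw [this]
  exact measurable_det_symMatrix.inv.mul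
    (continuous_symMatrix.matrix_adjugate.matrix_elem i j).measurable

/-- Positive definite means positive semidefinite with nonzero determinant. The uncountably many
inequalities of semidefiniteness cut out a closed set. -/
lemma measurableSet_posDef {K : ℕ} : MeasurableSet {v : UpperIdx K → ℝ | (symMatrix v).PosDef} := by
  have : {v : UpperIdx K → ℝ | (symMatrix v).PosDef} =
      {v | ∀ x : Fin K → ℝ, 0 ≤ x ⬝ᵥ (symMatrix v *ᵥ x)} ∩ {v | (symMatrix v).det ≠ 0} := by
    ext v
    simp only [Set.mem_inter_iff, Set.mem_ofPred_eq]
    constructor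
    · exact fun h => ⟨fun x => by simpa using h.posSemidef.dotProduct_mulVec_nonneg x, h.det_pos.ne'⟩
    · rintro ⟨h1, h2⟩
      have h3 : (symMatrix v).PosSemidef := Matrix.PosSemidef.of_dotProduct_mulVec_nonneg
        (by rw [Matrix.IsHermitian, Matrix.conjTranspose_eq_transpose_of_trivial,
              symMatrix_transpose]) (fun x => by simpa using h1 x)
      exact h3.posDef_iff_det_ne_zero.2 h2
  rw [this]
  refine MeasurableSet.inter (IsClosed.measurableSet ?_)
    (measurable_det_symMatrix (measurableSet_singleton 0).compl)
  rw [Set.ofPred_forall]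
  refine isClosed_iInter fun x => isClosed_le continuous_const ?_
  exact continuous_const.dotProduct (continuous_symMatrix.matrix_mulVec continuous_const)

lemma measurable_invWishartKernel_comp {K : ℕ} {E : Type*} [MeasurableSpace E]
    {Ψ : E → Matrix (Fin K) (Fin K) ℝ} (hΨ : ∀ i j, Measurable fun e => Ψ e i j) (ν : ℝ)
    {g : E → UpperIdx K → ℝ} (hg : Measurable g) :
    Measurable fun e => invWishartKernel (Ψ e) ν (symMatrix (g e)) := by
  have hset : MeasurableSet {e | (symMatrix (g e)).PosDef} := hg measurableSet_posDef
  have hdet : Measurable fun e => (symMatrix (g e)).det := measurable_det_symMatrix.comp hg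
  have hinv : ∀ i j, Measurable fun e => (symMatrix (g e))⁻¹ i j := fun i j =>
    (measurable_inv_symMatrix_apply i j).comp hg
  have htr : Measurable fun e => (Ψ e * (symMatrix (g e))⁻¹).trace := by
    simp only [Matrix.trace, Matrix.diag_apply, Matrix.mul_apply]
    exact Finset.measurable_sum _ fun i _ => Finset.measurable_sum _ fun j _ =>
      (hΨ i j).mul (hinv j i)
  exact Measurable.ite hset
    ((hdet.pow_const _).mul (Real.measurable_exp.comp (measurable_const.mul htr))) measurable_const

lemma measurable_invWishartKernel {K : ℕ} (Ψ : Matrix (Fin K) (Fin K) ℝ) (ν : ℝ) :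
    Measurable fun v : UpperIdx K → ℝ => invWishartKernel Ψ ν (symMatrix v) :=
  measurable_invWishartKernel_comp (Ψ := fun _ => Ψ) (fun _ _ => measurable_const) ν
    (g := fun v => v) measurable_id

lemma measurable_ofReal_invWishartKernel {K : ℕ} (Ψ : Matrix (Fin K) (Fin K) ℝ) (ν : ℝ) :
    Measurable fun v : UpperIdx K → ℝ => ENNReal.ofReal (invWishartKernel Ψ ν (symMatrix v)) :=
  ENNReal.measurable_ofReal.comp (measurable_invWishartKernel Ψ ν)

lemma invWishartKernel_nonneg {K : ℕ} (Ψ : Matrix (Fin K) (Fin K) ℝ) (ν : ℝ)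
    (S : Matrix (Fin K) (Fin K) ℝ) : 0 ≤ invWishartKernel Ψ ν S := by
  unfold invWishartKernel
  split_ifs with h
  · have := h.det_pos
    positivity
  · exact le_rfl

lemma invWishartKernel_congruence {K : ℕ} {A : Matrix (Fin K) (Fin K) ℝ} (hA : A.det ≠ 0)
    (Ψ : Matrix (Fin K) (Fin K) ℝ) (ν : ℝ) (S : Matrix (Fin K) (Fin K) ℝ) :
    invWishartKernel (A * Ψ * Aᵀ) ν (A * S * Aᵀ) =
      |A.det| ^ (-(ν + K + 1)) * invWishartKernel Ψ ν S := by
  by_cases hS : S.PosDef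
  · rw [invWishartKernel, invWishartKernel, if_pos hS, if_pos ((posDef_congruence_iff hA S).2 hS)]
    have htr : (A * Ψ * Aᵀ * (A * S * Aᵀ)⁻¹).trace = (Ψ * S⁻¹).trace := by
      have hu : IsUnit A.det := hA.isUnit
      have hu' : IsUnit (Aᵀ).det := by rwa [Matrix.det_transpose]
      rw [Matrix.mul_inv_rev, Matrix.mul_inv_rev, Matrix.mul_assoc (A * Ψ),
        ← Matrix.mul_assoc (Aᵀ), Matrix.mul_nonsing_inv _ hu', Matrix.one_mul, Matrix.mul_assoc A,
        Matrix.trace_mul_comm, Matrix.mul_assoc, Matrix.mul_assoc, Matrix.nonsing_inv_mul _ hu,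
        Matrix.mul_one]
    have hdet : (A * S * Aᵀ).det = |A.det| ^ (2 : ℝ) * S.det := by
      rw [Matrix.det_mul, Matrix.det_mul, Matrix.det_transpose, Real.rpow_two, sq_abs]; ring
    rw [htr, hdet, Real.mul_rpow (by positivity) hS.det_pos.le, ← Real.rpow_mul (abs_nonneg _)]
    rw [mul_assoc]
    congr 2
    ring
  · rw [invWishartKernel, invWishartKernel, if_neg hS,
      if_neg (fun h => hS ((posDef_congruence_iff hA S).1 h)), mul_zero]

/-- The normalizing integral of the inverse Wishart distribution, as an extended real. -/
noncomputable def invWishartMass {K : ℕ} (Ψ : Matrix (Fin K) (Fin K) ℝ) (ν : ℝ) : ℝ≥0∞ :=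
  ∫⁻ v : UpperIdx K → ℝ, ENNReal.ofReal (invWishartKernel Ψ ν (symMatrix v))

/-- Write `Ψ = A Aᵀ` and substitute `S ↦ A S Aᵀ`: the Jacobian `|det A|^(K+1)` and the kernel factor
`|det A|^(-(ν+K+1))` combine to `|det A|^(-ν)`. -/
lemma invWishartMass_eq {K : ℕ} {Ψ : Matrix (Fin K) (Fin K) ℝ} (hΨ : Ψ.PosDef) (ν : ℝ) :
    invWishartMass Ψ ν = ENNReal.ofReal (Ψ.det ^ (-(ν / 2))) *
      invWishartMass (1 : Matrix (Fin K) (Fin K) ℝ) ν := by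
  obtain ⟨A, hA, rfl⟩ := exists_eq_mul_transpose hΨ
  have hpos : 0 < |A.det| := abs_pos.2 hA
  rw [invWishartMass, lintegral_comp_congruence hA
    (measurable_ofReal_invWishartKernel _ ν)]
  have h1 : ∀ v, invWishartKernel (A * Aᵀ) ν (symMatrix (congruence A v)) =
      |A.det| ^ (-(ν + K + 1)) * invWishartKernel 1 ν (symMatrix v) := fun v => by
    rw [symMatrix_congruence, ← invWishartKernel_congruence hA, Matrix.mul_one]
  simp_rw [h1]
  simp_rw [ENNReal.ofReal_mul (Real.rpow_nonneg hpos.le _)]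
  rw [lintegral_const_mul _ (measurable_ofReal_invWishartKernel _ ν),
    ← mul_assoc, ← ENNReal.ofReal_mul (by positivity), invWishartMass]
  congr 2
  rw [Matrix.det_mul, Matrix.det_transpose, ← abs_mul_abs_self, ← Real.rpow_natCast,
    ← Real.rpow_add hpos, Real.mul_rpow hpos.le hpos.le, ← Real.rpow_add hpos]
  congr 1
  push_cast
  ring

/-- By Cauchy–Schwarz the perturbation changes the quadratic form by at most `K/(K+1)` times `∑
x_i²`. Hence the kernel is positive on a ball around the identity, which makes its integral nonzero.
-/
lemma posDef_of_abs_sub_one_lt {K : ℕ} {v : UpperIdx K → ℝ}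
    (hv : ∀ p, |v p - upperEntries 1 p| < ((K : ℝ) + 1)⁻¹) : (symMatrix v).PosDef := by
  refine Matrix.PosDef.of_dotProduct_mulVec_pos
    (by rw [Matrix.IsHermitian, Matrix.conjTranspose_eq_transpose_of_trivial,
          symMatrix_transpose]) fun {x} hx => ?_
  have hentry : ∀ i j, |symMatrix v i j - (1 : Matrix (Fin K) (Fin K) ℝ) i j| ≤
      ((K : ℝ) + 1)⁻¹ := by
    intro i j
    have h := (hv ⟨(min i j, max i j), min_le_max⟩).le
    have h1 : upperEntries (1 : Matrix (Fin K) (Fin K) ℝ) ⟨(min i j, max i j), min_le_max⟩ =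
        (1 : Matrix (Fin K) (Fin K) ℝ) i j := by
      rw [← symMatrix_apply (upperEntries (1 : Matrix (Fin K) (Fin K) ℝ)) i j,
        symMatrix_upperEntries Matrix.transpose_one]
    rwa [h1, ← symMatrix_apply v i j] at h
  have hsq : 0 < ∑ i, x i ^ 2 := by
    obtain ⟨i, hi⟩ := Function.ne_iff.1 hx
    exact Finset.sum_pos' (fun _ _ => sq_nonneg _) ⟨i, Finset.mem_univ _, by
      have : x i ≠ 0 := hi
      positivity⟩
  have hexp : star x ⬝ᵥ (symMatrix v *ᵥ x) = ∑ i, x i ^ 2 +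
      ∑ i, ∑ j, x i * x j * (symMatrix v i j - (1 : Matrix (Fin K) (Fin K) ℝ) i j) := by
    have h0 : ∑ i, x i ^ 2 = ∑ i, ∑ j, x i * x j * (1 : Matrix (Fin K) (Fin K) ℝ) i j := by
      refine Finset.sum_congr rfl fun i _ => ?_
      simp [Matrix.one_apply, sq]
    rw [h0, ← Finset.sum_add_distrib]
    simp only [dotProduct, Matrix.mulVec, star_trivial]
    refine Finset.sum_congr rfl fun i _ => ?_
    rw [← Finset.sum_add_distrib, Finset.mul_sum]
    refine Finset.sum_congr rfl fun j _ => ?_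
    ring
  have hlow : -(((K : ℝ) + 1)⁻¹ * (K * ∑ i, x i ^ 2)) ≤
      ∑ i, ∑ j, x i * x j * (symMatrix v i j - (1 : Matrix (Fin K) (Fin K) ℝ) i j) := by
    have h1 : ∀ i j, -(((K : ℝ) + 1)⁻¹ * (|x i| * |x j|)) ≤
        x i * x j * (symMatrix v i j - (1 : Matrix (Fin K) (Fin K) ℝ) i j) := by
      intro i j
      refine (neg_le_neg ?_).trans (neg_abs_le _)
      rw [abs_mul, abs_mul, mul_comm]
      exact mul_le_mul_of_nonneg_right (hentry i j) (by positivity)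
    refine le_trans ?_ (Finset.sum_le_sum fun i _ => Finset.sum_le_sum fun j _ => h1 i j)
    simp_rw [Finset.sum_neg_distrib, ← Finset.mul_sum]
    rw [← Finset.sum_mul]
    refine neg_le_neg (mul_le_mul_of_nonneg_left ?_ (by positivity))
    have h2 := sq_sum_le_card_mul_sum_sq (s := Finset.univ) (f := fun i => |x i|)
    simpa [sq] using h2
  rw [hexp]
  have h3 : ((K : ℝ) + 1)⁻¹ * (K * ∑ i, x i ^ 2) < ∑ i, x i ^ 2 := by
    rw [inv_mul_lt_iff₀ (by positivity)]
    nlinarith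
  linarith

lemma invWishartMass_one_ne_zero {K : ℕ} (ν : ℝ) :
    invWishartMass (1 : Matrix (Fin K) (Fin K) ℝ) ν ≠ 0 := by
  intro h0
  rw [invWishartMass, lintegral_eq_zero_iff
    (measurable_ofReal_invWishartKernel _ ν)] at h0
  have hnull : volume (Metric.ball (upperEntries (1 : Matrix (Fin K) (Fin K) ℝ))
      ((K : ℝ) + 1)⁻¹) = 0 := by
    refine measure_mono_null (fun v hv => ?_) h0
    have hpd : (symMatrix v).PosDef := by
      refine posDef_of_abs_sub_one_lt fun p => ?_
      rw [← Real.dist_eq]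
      exact (dist_le_pi_dist _ _ p).trans_lt hv
    have hd := hpd.det_pos
    have : 0 < invWishartKernel 1 ν (symMatrix v) := by
      rw [invWishartKernel, if_pos hpd]
      positivity
    change ¬ _
    simpa using this
  exact (Metric.measure_ball_pos volume _ (by positivity)).ne' hnull

lemma abs_apply_le_trace {K : ℕ} {S : Matrix (Fin K) (Fin K) ℝ} (hS : S.PosDef) (i j : Fin K) :
    |S i j| ≤ S.trace := by
  obtain ⟨A, -, rfl⟩ := exists_eq_mul_transpose hS
  have htr : (A * Aᵀ).trace = ∑ i, ∑ k, A i k ^ 2 := by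
    simp [Matrix.trace, Matrix.mul_apply, sq]
  have hle : ∀ i, ∑ k, A i k ^ 2 ≤ ∑ i, ∑ k, A i k ^ 2 := fun i =>
    Finset.single_le_sum (f := fun i => ∑ k, A i k ^ 2)
      (fun _ _ => Finset.sum_nonneg fun _ _ => sq_nonneg _) (Finset.mem_univ i)
  have h1 : |(A * Aᵀ) i j| ≤ ∑ k, (A i k ^ 2 + A j k ^ 2) / 2 := by
    rw [Matrix.mul_apply]
    refine (Finset.abs_sum_le_sum_abs _ _).trans (Finset.sum_le_sum fun k _ => ?_)
    rw [Matrix.transpose_apply, abs_le]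
    constructor <;> nlinarith [sq_nonneg (A i k + A j k), sq_nonneg (A i k - A j k)]
  rw [← Finset.sum_div, Finset.sum_add_distrib] at h1
  rw [htr]
  linarith [hle i, hle j]

lemma one_add_sum_le_prod_one_add {ι : Type*} (s : Finset ι) {f : ι → ℝ}
    (hf : ∀ i, 0 ≤ f i) : 1 + ∑ i ∈ s, f i ≤ ∏ i ∈ s, (1 + f i) := by
  classical
  induction s using Finset.induction_on with
  | empty => simp
  | insert a s ha ih =>
    rw [Finset.sum_insert ha, Finset.prod_insert ha]
    nlinarith [hf a, Finset.sum_nonneg fun i (_ : i ∈ s) => hf i]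

/-- With `u = t⁻¹`, the inequality `e^y ≥ 1 + y` gives `1 + u ≤ 2a exp(u/(2a))`; the claim is its
`a`-th power. The exponential removes the singularity at `t = 0` and the power decay at infinity
remains. -/
lemma rpow_neg_mul_exp_le {a t : ℝ} (ha : 1 ≤ a) (ht : 0 < t) :
    t ^ (-a) * Real.exp (-(1 / 2) * t⁻¹) ≤ (2 * a) ^ a * (1 + t) ^ (-a) := by
  have h1 : 1 + t⁻¹ ≤ 2 * a * Real.exp (t⁻¹ / (2 * a)) := by
    have h := Real.add_one_le_exp (t⁻¹ / (2 * a))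
    have h2 : 2 * a * (t⁻¹ / (2 * a) + 1) ≤ 2 * a * Real.exp (t⁻¹ / (2 * a)) :=
      mul_le_mul_of_nonneg_left h (by linarith)
    have h3 : 2 * a * (t⁻¹ / (2 * a) + 1) = t⁻¹ + 2 * a := by field_simp
    linarith
  have h2 : (1 + t⁻¹) ^ a ≤ (2 * a) ^ a * Real.exp ((1 / 2) * t⁻¹) := by
    refine (Real.rpow_le_rpow (by positivity) h1 (by linarith)).trans_eq ?_
    rw [Real.mul_rpow (by positivity) (Real.exp_pos _).le, ← Real.exp_mul]
    congr 2
    field_simp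
  have h3 : 1 + t = t * (1 + t⁻¹) := by field_simp; ring
  rw [h3, Real.mul_rpow ht.le (by positivity), Real.rpow_neg (by positivity) (x := 1 + t⁻¹)]
  have h4 : Real.exp (-(1 / 2) * t⁻¹) ≤ (2 * a) ^ a * ((1 + t⁻¹) ^ a)⁻¹ := by
    rw [neg_mul, Real.exp_neg, ← div_eq_mul_inv ((2 * a) ^ a), le_div_iff₀ (by positivity),
      inv_mul_le_iff₀ (Real.exp_pos _)]
    linarith
  calc t ^ (-a) * Real.exp (-(1 / 2) * t⁻¹)
      ≤ t ^ (-a) * ((2 * a) ^ a * ((1 + t⁻¹) ^ a)⁻¹) :=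
        mul_le_mul_of_nonneg_left h4 (by positivity)
    _ = _ := by ring

lemma trace_inv_eq_sum {K : ℕ} {S : Matrix (Fin K) (Fin K) ℝ} (hS : S.PosDef) :
    (S⁻¹).trace = ∑ i, (hS.isHermitian.eigenvalues i)⁻¹ := by
  have hev := hS.eigenvalues_pos
  set U := hS.isHermitian.eigenvectorUnitary with hU
  set lam := hS.isHermitian.eigenvalues with hlam
  have hspec : S = (U : Matrix (Fin K) (Fin K) ℝ) * Matrix.diagonal lam *
      star (U : Matrix (Fin K) (Fin K) ℝ) := by
    have h := hS.isHermitian.spectral_theorem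
    rw [Unitary.conjStarAlgAut_apply] at h
    exact h
  have hUU : star (U : Matrix (Fin K) (Fin K) ℝ) * (U : Matrix (Fin K) (Fin K) ℝ) = 1 :=
    Unitary.coe_star_mul_self U
  have hUU' : (U : Matrix (Fin K) (Fin K) ℝ) * star (U : Matrix (Fin K) (Fin K) ℝ) = 1 :=
    Unitary.coe_mul_star_self U
  have hd : Matrix.diagonal lam * Matrix.diagonal (fun i => (lam i)⁻¹) = 1 := by
    rw [Matrix.diagonal_mul_diagonal, ← Matrix.diagonal_one]
    congr 1
    funext i
    exact mul_inv_cancel₀ (hev i).ne'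
  have hinv : S⁻¹ = (U : Matrix (Fin K) (Fin K) ℝ) * Matrix.diagonal (fun i => (lam i)⁻¹) *
      star (U : Matrix (Fin K) (Fin K) ℝ) := by
    refine Matrix.inv_eq_right_inv ?_
    conv_lhs => rw [hspec]
    calc _ = (U : Matrix (Fin K) (Fin K) ℝ) * Matrix.diagonal lam *
          (star (U : Matrix (Fin K) (Fin K) ℝ) * (U : Matrix (Fin K) (Fin K) ℝ)) *
          Matrix.diagonal (fun i => (lam i)⁻¹) * star (U : Matrix (Fin K) (Fin K) ℝ) := by
            simp only [Matrix.mul_assoc]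
      _ = 1 := by
        rw [hUU, Matrix.mul_one, Matrix.mul_assoc (U : Matrix (Fin K) (Fin K) ℝ), hd,
          Matrix.mul_one, hUU']
  rw [hinv, Matrix.trace_mul_comm, ← Matrix.mul_assoc, hUU, Matrix.one_mul, Matrix.trace_diagonal]

/-- The kernel factors over the eigenvalues of `S`. After the one-variable bound, `∏ (1 + λ_i) ≥ 1 +
tr S ≥ 1 + ‖v‖` leaves polynomial decay in the norm. -/
lemma invWishartKernel_one_le {K : ℕ} {ν : ℝ} (hν : 1 ≤ ν) (v : UpperIdx K → ℝ) :
    invWishartKernel 1 ν (symMatrix v) ≤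
      ((2 * ((ν + K + 1) / 2)) ^ ((ν + K + 1) / 2)) ^ K * (1 + ‖v‖) ^ (-((ν + K + 1) / 2)) := by
  set a := (ν + K + 1) / 2 with ha
  have hK : (0 : ℝ) ≤ K := Nat.cast_nonneg K
  have ha1 : 1 ≤ a := by rw [ha]; linarith
  by_cases hS : (symMatrix v).PosDef
  · have hev := hS.eigenvalues_pos
    rw [invWishartKernel, if_pos hS, Matrix.one_mul, trace_inv_eq_sum hS,
      hS.isHermitian.det_eq_prod_eigenvalues, Finset.mul_sum, Real.exp_sum]
    have htr := hS.isHermitian.trace_eq_sum_eigenvalues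
    set lam := hS.isHermitian.eigenvalues with hlam
    simp only [RCLike.ofReal_real_eq_id, id] at htr ⊢
    rw [← Real.finsetProd_rpow _ _ (fun i _ => (hev i).le), ← Finset.prod_mul_distrib]
    have h1 : ∏ i, (lam i ^ (-a) * Real.exp (-(1 / 2) * (lam i)⁻¹)) ≤
        ∏ i, ((2 * a) ^ a * (1 + lam i) ^ (-a)) :=
      Finset.prod_le_prod (fun i _ => by have := hev i; positivity)
        fun i _ => rpow_neg_mul_exp_le ha1 (hev i)
    refine h1.trans ?_
    rw [Finset.prod_mul_distrib, Finset.prod_const, Finset.card_univ, Fintype.card_fin,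
      Real.finsetProd_rpow _ _ (fun i _ => by have := hev i; positivity)]
    refine mul_le_mul_of_nonneg_left ?_ (by positivity)
    refine Real.rpow_le_rpow_of_nonpos (by positivity) ?_ (by linarith)
    refine le_trans ?_ (one_add_sum_le_prod_one_add _ fun i => (hev i).le)
    rw [← htr]
    have htr0 : 0 ≤ (symMatrix v).trace := by
      rw [htr]; exact Finset.sum_nonneg fun i _ => (hev i).le
    have : ‖v‖ ≤ (symMatrix v).trace := by
      refine (pi_norm_le_iff_of_nonneg htr0).2 fun p => ?_
      have h := abs_apply_le_trace hS p.1.1 p.1.2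
      rwa [show symMatrix v p.1.1 p.1.2 = v p from congrFun (upperEntries_symMatrix v) p] at h
    linarith
  · rw [invWishartKernel, if_neg hS]
    positivity

/-- The bound on `ν` puts the decay exponent above the dimension of the space of symmetric matrices.
This crude range is enough because the posterior degrees of freedom tend to infinity. -/
lemma invWishartMass_one_ne_top {K : ℕ} {ν : ℝ} (hν1 : 1 ≤ ν)
    (hν : 2 * (Fintype.card (UpperIdx K) : ℝ) ≤ ν) :
    invWishartMass (1 : Matrix (Fin K) (Fin K) ℝ) ν ≠ ⊤ := by
  have hK : (0 : ℝ) ≤ K := Nat.cast_nonneg K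
  have hint : Integrable fun v : UpperIdx K → ℝ => (1 + ‖v‖) ^ (-((ν + K + 1) / 2)) := by
    refine integrable_one_add_norm ?_
    rw [Module.finrank_fintype_fun_eq_card]
    linarith
  refine ne_top_of_le_ne_top (hint.const_mul _).lintegral_lt_top.ne
    (lintegral_mono fun v => ENNReal.ofReal_le_ofReal (invWishartKernel_one_le hν1 v))

/-! ### The marginal distribution of the mean under a normal-inverse-Wishart distribution -/

lemma lintegral_comp_mulVec {K : ℕ} {A : Matrix (Fin K) (Fin K) ℝ} (hA : A.det ≠ 0)
    {f : (Fin K → ℝ) → ℝ≥0∞} (hf : Measurable f) :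
    ∫⁻ x, f x = ENNReal.ofReal |A.det| * ∫⁻ y, f (A *ᵥ y) := by
  have hm : Measurable (Matrix.toLin' A) :=
    (LinearMap.continuous_of_finiteDimensional _).measurable
  have h := lintegral_map (μ := volume) hf hm
  simp only [Matrix.toLin'_apply] at h
  rw [← h, Real.map_matrix_volume_pi_eq_smul_volume_pi hA,
    lintegral_smul_measure, smul_eq_mul, ← mul_assoc, ← ENNReal.ofReal_mul (by positivity),
    abs_inv, mul_inv_cancel₀ (by positivity), ENNReal.ofReal_one, one_mul]

lemma mulVec_dotProduct_inv_mulVec {K : ℕ} {A : Matrix (Fin K) (Fin K) ℝ} (hA : A.det ≠ 0)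
    (y : Fin K → ℝ) : (A *ᵥ y) ⬝ᵥ ((A * Aᵀ)⁻¹ *ᵥ (A *ᵥ y)) = y ⬝ᵥ y := by
  have hu : IsUnit A.det := hA.isUnit
  have hu' : IsUnit (Aᵀ).det := by rwa [Matrix.det_transpose]
  rw [Matrix.mulVec_mulVec, Matrix.mul_inv_rev, Matrix.mul_assoc, Matrix.nonsing_inv_mul _ hu,
    Matrix.mul_one, Matrix.dotProduct_mulVec, ← Matrix.mulVec_transpose, Matrix.mulVec_mulVec,
    Matrix.transpose_nonsing_inv, Matrix.transpose_transpose, Matrix.nonsing_inv_mul _ hu,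
    Matrix.one_mulVec]

lemma measurable_dotProduct_mulVec {K : ℕ} (m : Fin K → ℝ) (S : Matrix (Fin K) (Fin K) ℝ) :
    Measurable fun x : Fin K → ℝ => (x - m) ⬝ᵥ (S *ᵥ (x - m)) :=
  ((continuous_id.sub continuous_const).dotProduct
    (continuous_const.matrix_mulVec (continuous_id.sub continuous_const))).measurable

lemma measurable_dotProduct_self {K : ℕ} : Measurable fun x : Fin K → ℝ => x ⬝ᵥ x :=
  (continuous_id.dotProduct continuous_id).measurable

lemma integrable_exp_neg_dotProduct {K : ℕ} {b : ℝ} (hb : 0 < b) :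
    Integrable fun y : Fin K → ℝ => Real.exp (-b * (y ⬝ᵥ y)) := by
  have h : (fun y : Fin K → ℝ => Real.exp (-b * (y ⬝ᵥ y))) =
      fun y => ∏ i, Real.exp (-b * y i ^ 2) := by
    funext y
    rw [dotProduct, Finset.mul_sum, Real.exp_sum]
    simp only [sq]
  rw [h]
  exact Integrable.fintype_prod (f := fun _ x => Real.exp (-b * x ^ 2))
    fun _ => integrable_exp_neg_mul_sq hb

lemma integral_exp_neg_dotProduct {K : ℕ} (b : ℝ) :
    ∫ y : Fin K → ℝ, Real.exp (-b * (y ⬝ᵥ y)) = √(Real.pi / b) ^ K := by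
  have h : ∀ y : Fin K → ℝ, Real.exp (-b * (y ⬝ᵥ y)) = ∏ i, Real.exp (-b * y i ^ 2) := by
    intro y
    rw [dotProduct, Finset.mul_sum, Real.exp_sum]
    simp only [sq]
  simp_rw [h]
  rw [integral_fintype_prod_volume_eq_prod (fun (_ : Fin K) (x : ℝ) => Real.exp (-b * x ^ 2))]
  simp only [integral_gaussian, Finset.prod_const, Finset.card_univ, Fintype.card_fin]

lemma measurable_gaussianDensity {K : ℕ} (m : Fin K → ℝ) (S : Matrix (Fin K) (Fin K) ℝ) :
    Measurable (gaussianDensity m S) :=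
  measurable_const.mul
    (Real.measurable_exp.comp (measurable_const.mul (measurable_dotProduct_mulVec m S⁻¹)))

lemma lintegral_gaussianDensity {K : ℕ} (m : Fin K → ℝ) {S : Matrix (Fin K) (Fin K) ℝ}
    (hS : S.PosDef) : ∫⁻ x, ENNReal.ofReal (gaussianDensity m S x) = 1 := by
  have hSdet := hS.det_pos
  obtain ⟨A, hA, rfl⟩ := exists_eq_mul_transpose hS
  have hm : Measurable fun x => ENNReal.ofReal (gaussianDensity m (A * Aᵀ) (x + m)) :=
    ENNReal.measurable_ofReal.comp
      ((measurable_gaussianDensity _ _).comp (measurable_id.add_const m))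
  rw [← lintegral_add_right_eq_self _ m, lintegral_comp_mulVec hA hm]
  have h1 : ∀ y, gaussianDensity m (A * Aᵀ) (A *ᵥ y + m) =
      (√((2 * Real.pi) ^ K * (A * Aᵀ).det))⁻¹ * Real.exp (-(1 / 2) * (y ⬝ᵥ y)) := fun y => by
    rw [gaussianDensity, add_sub_cancel_right, mulVec_dotProduct_inv_mulVec hA]
  simp_rw [h1]
  rw [← ofReal_integral_eq_lintegral_ofReal
    ((integrable_exp_neg_dotProduct (by norm_num)).const_mul _)
    (Eventually.of_forall fun y => by positivity), integral_const_mul, integral_exp_neg_dotProduct,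
    ← ENNReal.ofReal_mul (abs_nonneg _), ← ENNReal.ofReal_one]
  congr 1
  have e1 : √((2 * Real.pi) ^ K * (A * Aᵀ).det) = √(2 * Real.pi) ^ K * |A.det| := by
    rw [Real.sqrt_mul (by positivity), Matrix.det_mul, Matrix.det_transpose,
      Real.sqrt_mul_self_eq_abs, Real.sqrt_eq_rpow, Real.sqrt_eq_rpow, ← Real.rpow_natCast,
      ← Real.rpow_natCast, ← Real.rpow_mul (by positivity), ← Real.rpow_mul (by positivity),
      mul_comm (K : ℝ)]
  have e2 : Real.pi / (1 / 2) = 2 * Real.pi := by ring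
  have hpos : 0 < |A.det| := abs_pos.2 hA
  have hpi : 0 < √(2 * Real.pi) := Real.sqrt_pos.2 (by positivity)
  rw [e1, e2]
  field_simp

/-- Conjugacy: `λ uᵀ S⁻¹ u = tr(λ u uᵀ S⁻¹)` is absorbed into the scale matrix, and the Gaussian
factor `det(S)^(-1/2)` raises the degrees of freedom by one. -/
lemma gaussianDensity_mul_invWishartKernel {K : ℕ} (m : Fin K → ℝ) {lam : ℝ} (hlam : 0 < lam)
    (Ψ : Matrix (Fin K) (Fin K) ℝ) (ν : ℝ) (S : Matrix (Fin K) (Fin K) ℝ) (x : Fin K → ℝ) :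
    gaussianDensity m (lam⁻¹ • S) x * invWishartKernel Ψ ν S =
      (√((2 * Real.pi) ^ K * lam⁻¹ ^ K))⁻¹ *
        invWishartKernel (Ψ + lam • Matrix.vecMulVec (x - m) (x - m)) (ν + 1) S := by
  by_cases hS : S.PosDef
  · have hd := hS.det_pos
    have hinv : (lam⁻¹ • S)⁻¹ = lam • S⁻¹ := by
      refine Matrix.inv_eq_right_inv ?_
      rw [Matrix.smul_mul, Matrix.mul_smul, smul_smul, inv_mul_cancel₀ hlam.ne',
        Matrix.mul_nonsing_inv _ hd.ne'.isUnit, one_smul]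
    rw [invWishartKernel, invWishartKernel, if_pos hS, if_pos hS, gaussianDensity, hinv,
      Matrix.det_smul, Fintype.card_fin, ← mul_assoc ((2 * Real.pi) ^ K),
      Real.sqrt_mul (by positivity) S.det,
      Matrix.add_mul, Matrix.trace_add, Matrix.smul_mul, Matrix.trace_smul,
      Matrix.vecMulVec_mul, Matrix.trace_vecMulVec, Matrix.smul_mulVec, dotProduct_smul,
      Matrix.dotProduct_mulVec, dotProduct_comm (x - m)]
    have hr : S.det ^ (-((ν + 1 + K + 1) / 2)) = (√S.det)⁻¹ * S.det ^ (-((ν + K + 1) / 2)) := by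
      rw [Real.sqrt_eq_rpow, ← Real.rpow_neg hd.le, ← Real.rpow_add hd]
      congr 1
      ring
    rw [hr, mul_add, Real.exp_add, mul_inv]
    ring
  · rw [invWishartKernel, invWishartKernel, if_neg hS, if_neg hS, mul_zero, mul_zero]

lemma det_add_smul_vecMulVec {K : ℕ} {Ψ : Matrix (Fin K) (Fin K) ℝ} (hΨ : IsUnit Ψ.det) (a : ℝ)
    (u : Fin K → ℝ) :
    (Ψ + a • Matrix.vecMulVec u u).det = Ψ.det * (1 + a * (u ⬝ᵥ (Ψ⁻¹ *ᵥ u))) := by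
  have h := Matrix.det_one_add_replicateCol_mul_replicateRow (ι := Unit) (a • (Ψ⁻¹ *ᵥ u)) u
  rw [dotProduct_smul, smul_eq_mul] at h
  rw [← h, ← Matrix.det_mul, mul_add, mul_one, ← Matrix.vecMulVec_eq, Matrix.smul_vecMulVec,
    Matrix.mul_smul, Matrix.mul_vecMulVec, Matrix.mulVec_mulVec, Matrix.mul_nonsing_inv _ hΨ,
    Matrix.one_mulVec]

lemma posDef_add_smul_vecMulVec {K : ℕ} {Ψ : Matrix (Fin K) (Fin K) ℝ} (hΨ : Ψ.PosDef) {a : ℝ}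
    (ha : 0 ≤ a) (u : Fin K → ℝ) : (Ψ + a • Matrix.vecMulVec u u).PosDef := by
  refine hΨ.add_posSemidef (Matrix.PosSemidef.smul ?_ ha)
  simpa using Matrix.posSemidef_vecMulVec_self_star u

lemma lintegral_invWishartDensity {K : ℕ} {Ψ : Matrix (Fin K) (Fin K) ℝ} {ν : ℝ}
    (h0 : invWishartMass Ψ ν ≠ 0) (htop : invWishartMass Ψ ν ≠ ⊤) :
    ∫⁻ v : UpperIdx K → ℝ, ENNReal.ofReal (invWishartDensity Ψ ν (symMatrix v)) = 1 := by
  have hC : ∫ v : UpperIdx K → ℝ, invWishartKernel Ψ ν (symMatrix v) =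
      (invWishartMass Ψ ν).toReal :=
    integral_eq_lintegral_of_nonneg_ae (Eventually.of_forall fun v => invWishartKernel_nonneg _ _ _)
      (measurable_invWishartKernel Ψ ν).aestronglyMeasurable
  have hpos : 0 < (invWishartMass Ψ ν).toReal := ENNReal.toReal_pos h0 htop
  simp_rw [invWishartDensity, hC, ENNReal.ofReal_div_of_pos hpos, div_eq_mul_inv]
  rw [lintegral_mul_const _ (measurable_ofReal_invWishartKernel Ψ ν), ENNReal.ofReal_toReal htop]
  exact ENNReal.mul_inv_cancel h0 htop

lemma invWishartDensity_eq_zero {K : ℕ} {Ψ : Matrix (Fin K) (Fin K) ℝ} {ν : ℝ}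
    {S : Matrix (Fin K) (Fin K) ℝ} (hS : ¬ S.PosDef) : invWishartDensity Ψ ν S = 0 := by
  rw [invWishartDensity, invWishartKernel, if_neg hS, zero_div]

/-- The density of `niw h`, up to a constant, in terms of a single inverse Wishart kernel. -/
lemma niw_density_eq {K : ℕ} (h : NIWParams K) (hscale : 0 < h.scale) :
    ∃ a : ℝ, ∀ p : (Fin K → ℝ) × (UpperIdx K → ℝ),
      gaussianDensity h.mean (h.scale⁻¹ • symMatrix p.2) p.1 *
        invWishartDensity h.psi h.dof (symMatrix p.2) =
      a * invWishartKernel (h.psi + h.scale • Matrix.vecMulVec (p.1 - h.mean) (p.1 - h.mean))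
        (h.dof + 1) (symMatrix p.2) ∧ 0 ≤ a := by
  refine ⟨(√((2 * Real.pi) ^ K * h.scale⁻¹ ^ K))⁻¹ /
    ∫ v : UpperIdx K → ℝ, invWishartKernel h.psi h.dof (symMatrix v), fun p => ⟨?_, ?_⟩⟩
  · rw [invWishartDensity, ← mul_div_assoc, gaussianDensity_mul_invWishartKernel _ hscale,
      mul_div_right_comm]
  · exact div_nonneg (by positivity)
      (integral_nonneg fun v => invWishartKernel_nonneg _ _ _)

lemma measurable_niw_kernel {K : ℕ} (h : NIWParams K) :
    Measurable fun p : (Fin K → ℝ) × (UpperIdx K → ℝ) =>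
      invWishartKernel (h.psi + h.scale • Matrix.vecMulVec (p.1 - h.mean) (p.1 - h.mean))
        (h.dof + 1) (symMatrix p.2) := by
  refine measurable_invWishartKernel_comp (fun i j => ?_) _ measurable_snd
  simp only [Matrix.add_apply, Matrix.smul_apply, Matrix.vecMulVec_apply, Pi.sub_apply, smul_eq_mul]
  have hm : ∀ i, Measurable fun p : (Fin K → ℝ) × (UpperIdx K → ℝ) => p.1 i - h.mean i :=
    fun i => ((measurable_pi_apply i).comp measurable_fst).sub_const _
  exact measurable_const.add (measurable_const.mul ((hm i).mul (hm j)))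

lemma measurable_niw_density {K : ℕ} (h : NIWParams K) (hscale : 0 < h.scale) :
    Measurable fun p : (Fin K → ℝ) × (UpperIdx K → ℝ) => ENNReal.ofReal
      (gaussianDensity h.mean (h.scale⁻¹ • symMatrix p.2) p.1 *
        invWishartDensity h.psi h.dof (symMatrix p.2)) := by
  obtain ⟨a, ha⟩ := niw_density_eq h hscale
  simp_rw [fun p => (ha p).1]
  exact ENNReal.measurable_ofReal.comp (measurable_const.mul (measurable_niw_kernel h))

lemma niw_univ {K : ℕ} (h : NIWParams K) (hscale : 0 < h.scale)
    (h0 : invWishartMass h.psi h.dof ≠ 0) (htop : invWishartMass h.psi h.dof ≠ ⊤) :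
    niw h Set.univ = 1 := by
  -- Integrating over the mean first leaves exactly the inverse Wishart density, since each Gaussian
  -- integrates to 1.
  rw [niw, withDensity_apply _ MeasurableSet.univ, Measure.restrict_univ, Measure.volume_eq_prod,
    lintegral_prod_symm' _ (measurable_niw_density h hscale),
    ← lintegral_invWishartDensity h0 htop]
  refine lintegral_congr fun v => ?_
  by_cases hS : (symMatrix v).PosDef
  · have hS' : (h.scale⁻¹ • symMatrix v).PosDef := hS.smul (inv_pos.2 hscale)
    have hg : ∀ x, 0 ≤ gaussianDensity h.mean (h.scale⁻¹ • symMatrix v) x := fun x =>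
      mul_nonneg (by positivity) (Real.exp_pos _).le
    have hm : Measurable fun x => ENNReal.ofReal
        (gaussianDensity h.mean (h.scale⁻¹ • symMatrix v) x) :=
      ENNReal.measurable_ofReal.comp (measurable_gaussianDensity _ _)
    refine (lintegral_congr fun x => ENNReal.ofReal_mul (hg x)).trans
      ((lintegral_mul_const
        (ENNReal.ofReal (invWishartDensity h.psi h.dof (symMatrix v))) hm).trans ?_)
    rw [lintegral_gaussianDensity _ hS', one_mul]
  · simp_rw [invWishartDensity_eq_zero hS, mul_zero, ENNReal.ofReal_zero]
    exact lintegral_zero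

/-- The marginal of the mean is a multivariate `t` distribution. -/
lemma map_fst_niw {K : ℕ} (h : NIWParams K) (hscale : 0 < h.scale) (hpsi : h.psi.PosDef) :
    ∃ κ : ℝ≥0∞, (niw h).map Prod.fst = volume.withDensity fun x => κ * ENNReal.ofReal
      ((1 + h.scale * ((x - h.mean) ⬝ᵥ (h.psi⁻¹ *ᵥ (x - h.mean)))) ^ (-((h.dof + 1) / 2))) := by
  obtain ⟨a, ha⟩ := niw_density_eq h hscale
  have hdet := hpsi.det_pos
  -- Integrating out `S` gives `det(Ψ + λ u uᵀ)^(-(ν+1)/2)`; the matrix determinant lemma splits off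
  -- the constant `det Ψ` from the factor that depends on `x`.
  refine ⟨ENNReal.ofReal a * (ENNReal.ofReal (h.psi.det ^ (-((h.dof + 1) / 2))) *
    invWishartMass (1 : Matrix (Fin K) (Fin K) ℝ) (h.dof + 1)), ?_⟩
  refine Measure.ext fun B hB => ?_
  rw [Measure.map_apply measurable_fst hB, withDensity_apply _ hB, niw,
    withDensity_apply _ (measurable_fst hB), ← Set.prod_univ, Measure.volume_eq_prod,
    setLIntegral_prod _ (measurable_niw_density h hscale).aemeasurable]
  refine setLIntegral_congr_fun hB fun x _ => ?_
  have hq : 0 ≤ (x - h.mean) ⬝ᵥ (h.psi⁻¹ *ᵥ (x - h.mean)) := by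
    simpa using hpsi.inv.posSemidef.dotProduct_mulVec_nonneg (x - h.mean)
  rw [Measure.restrict_univ]
  have hm : Measurable fun v : UpperIdx K → ℝ => ENNReal.ofReal (invWishartKernel
      (h.psi + h.scale • Matrix.vecMulVec (x - h.mean) (x - h.mean)) (h.dof + 1) (symMatrix v)) :=
    measurable_ofReal_invWishartKernel _ _
  have e1 : ∀ v : UpperIdx K → ℝ, ENNReal.ofReal
      (gaussianDensity h.mean (h.scale⁻¹ • symMatrix v) x *
        invWishartDensity h.psi h.dof (symMatrix v)) = ENNReal.ofReal a *
      ENNReal.ofReal (invWishartKernel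
      (h.psi + h.scale • Matrix.vecMulVec (x - h.mean) (x - h.mean)) (h.dof + 1) (symMatrix v)) :=
    fun v => by rw [(ha (x, v)).1, ENNReal.ofReal_mul (ha (x, v)).2]
  simp_rw [e1]
  rw [lintegral_const_mul _ hm, ← invWishartMass,
    invWishartMass_eq (posDef_add_smul_vecMulVec hpsi hscale.le _),
    det_add_smul_vecMulVec hdet.ne'.isUnit, Real.mul_rpow hdet.le (by positivity),
    ENNReal.ofReal_mul (by positivity)]
  ring

/-! ### Concentration of the multivariate `t` distribution -/

/-- Bounds the mass of the standardized `t` density below by a Gaussian integral, uniformly in the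
degrees of freedom. -/
lemma exp_neg_le_rpow {p t : ℝ} (hp : 0 < p) (ht : 0 ≤ t) :
    Real.exp (-1 * t) ≤ (1 + t / p) ^ (-p) := by
  rw [Real.rpow_neg (by positivity), neg_one_mul, Real.exp_neg]
  refine inv_anti₀ (by positivity) ?_
  calc (1 + t / p) ^ p ≤ Real.exp (t / p) ^ p := by
        refine Real.rpow_le_rpow (by positivity) ?_ hp.le
        rw [add_comm]; exact Real.add_one_le_exp _
    _ = Real.exp t := by rw [← Real.exp_mul, div_mul_cancel₀ _ hp.ne']

/-- By Bernoulli, `(1 + t/p)^p` grows with `p`, so it is at least `(1 + t/q)^q ≥ ((1 + t)/q)^q`. The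
bound is uniform over `p ≥ q`. -/
lemma mul_rpow_le {p q t : ℝ} (hq : 1 ≤ q) (hpq : q ≤ p) (ht : 0 ≤ t) :
    t * (1 + t / p) ^ (-p) ≤ q ^ q * (1 + t) ^ (-(q - 1)) := by
  have hq0 : 0 < q := by linarith
  have hp0 : 0 < p := by linarith
  have h1 : 1 + t / q ≤ (1 + t / p) ^ (p / q) := by
    have h := one_add_mul_self_le_rpow_one_add (s := t / p) (by linarith [div_nonneg ht hp0.le])
      (p := p / q) (by rwa [le_div_iff₀ hq0, one_mul])
    have e : p / q * (t / p) = t / q := by field_simp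
    rwa [e] at h
  have h2 : (1 + t / q) ^ q ≤ (1 + t / p) ^ p := by
    refine (Real.rpow_le_rpow (by positivity) h1 hq0.le).trans_eq ?_
    rw [← Real.rpow_mul (by positivity), div_mul_cancel₀ _ hq0.ne']
  have h3 : (1 + t) / q ≤ 1 + t / q := by
    rw [add_div]
    have : 1 / q ≤ 1 := by rw [div_le_one hq0]; exact hq
    linarith
  have h4 : (1 + t / p) ^ (-p) ≤ q ^ q * (1 + t) ^ (-q) := by
    rw [Real.rpow_neg (by positivity), Real.rpow_neg (by positivity), ← div_eq_mul_inv (q ^ q),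
      ← inv_div ((1 + t) ^ q), ← Real.div_rpow (by positivity) hq0.le]
    exact inv_anti₀ (by positivity)
      ((Real.rpow_le_rpow (by positivity) h3 hq0.le).trans h2)
  calc t * (1 + t / p) ^ (-p) ≤ (1 + t) * (q ^ q * (1 + t) ^ (-q)) :=
        mul_le_mul (by linarith) h4 (by positivity) (by positivity)
    _ = q ^ q * (1 + t) ^ (-(q - 1)) := by
        rw [show -(q - 1) = 1 + -q by ring, Real.rpow_add (by positivity), Real.rpow_one]
        ring

lemma norm_sq_le_dotProduct {K : ℕ} (y : Fin K → ℝ) : ‖y‖ ^ 2 ≤ y ⬝ᵥ y := by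
  have h0 : 0 ≤ y ⬝ᵥ y := Finset.sum_nonneg fun i _ => mul_self_nonneg _
  have h : ‖y‖ ≤ √(y ⬝ᵥ y) := by
    refine (pi_norm_le_iff_of_nonneg (Real.sqrt_nonneg _)).2 fun i => ?_
    rw [Real.norm_eq_abs]
    refine Real.abs_le_sqrt ?_
    rw [sq]
    exact Finset.single_le_sum (f := fun i => y i * y i) (fun _ _ => mul_self_nonneg _)
      (Finset.mem_univ i)
  calc ‖y‖ ^ 2 ≤ √(y ⬝ᵥ y) ^ 2 := pow_le_pow_left₀ (norm_nonneg _) h 2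
    _ = _ := Real.sq_sqrt h0

lemma exists_lintegral_dotProduct_rpow_le (K : ℕ) : ∃ M : ℝ≥0∞, M ≠ ⊤ ∧ ∀ p : ℝ, (K : ℝ) + 2 ≤ p →
    ∫⁻ y : Fin K → ℝ, ENNReal.ofReal (y ⬝ᵥ y) * ENNReal.ofReal ((1 + (y ⬝ᵥ y) / p) ^ (-p)) ≤ M := by
  -- With this `q` the dominating function decays like `‖y‖^(-2(K+1))`, which is integrable in
  -- dimension `K`.
  set q : ℝ := (K : ℝ) + 2 with hq
  have hK : (0 : ℝ) ≤ K := Nat.cast_nonneg K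
  have hint : Integrable fun y : Fin K → ℝ => (1 + ‖y‖ ^ 2) ^ (-(2 * (q - 1)) / 2) := by
    refine integrable_rpow_neg_one_add_norm_sq ?_
    rw [Module.finrank_fintype_fun_eq_card, Fintype.card_fin]
    linarith
  refine ⟨_, (hint.const_mul (q ^ q)).lintegral_lt_top.ne, fun p hp => lintegral_mono fun y => ?_⟩
  have h0 : 0 ≤ y ⬝ᵥ y := (sq_nonneg _).trans (norm_sq_le_dotProduct y)
  rw [← ENNReal.ofReal_mul h0]
  refine ENNReal.ofReal_le_ofReal ((mul_rpow_le (by linarith) hp h0).trans ?_)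
  rw [show -(2 * (q - 1)) / 2 = -(q - 1) by ring]
  refine mul_le_mul_of_nonneg_left ?_ (by positivity)
  exact Real.rpow_le_rpow_of_nonpos (by positivity) (by linarith [norm_sq_le_dotProduct y])
    (by linarith)

lemma lintegral_exp_neg_dotProduct_ne_zero (K : ℕ) :
    ∫⁻ y : Fin K → ℝ, ENNReal.ofReal (Real.exp (-1 * (y ⬝ᵥ y))) ≠ 0 := by
  rw [← ofReal_integral_eq_lintegral_ofReal (integrable_exp_neg_dotProduct one_pos)
    (Eventually.of_forall fun y => (Real.exp_pos _).le), integral_exp_neg_dotProduct]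
  have := Real.pi_pos
  rw [div_one, Ne, ENNReal.ofReal_eq_zero, not_le]
  positivity

lemma mulVec_dotProduct_self_le {K : ℕ} (A : Matrix (Fin K) (Fin K) ℝ) (y : Fin K → ℝ) :
    (A *ᵥ y) ⬝ᵥ (A *ᵥ y) ≤ (A * Aᵀ).trace * (y ⬝ᵥ y) := by
  simp only [Matrix.trace, Matrix.diag_apply, Matrix.mul_apply, Matrix.transpose_apply]
  rw [dotProduct, Finset.sum_mul]
  refine Finset.sum_le_sum fun i _ => ?_
  have h := Finset.sum_mul_sq_le_sq_mul_sq Finset.univ (fun j => A i j) y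
  simp only [Matrix.mulVec, dotProduct]
  simp only [sq] at h
  exact h

/-- Change of variables bringing the multivariate `t` density to standard form. -/
lemma lintegral_map_fst_niw {K : ℕ} (h : NIWParams K) (hscale : 0 < h.scale) (hpsi : h.psi.PosDef)
    (hdof : 0 < h.dof) :
    ∃ (B : Matrix (Fin K) (Fin K) ℝ) (κ : ℝ≥0∞),
      (B * Bᵀ).trace = h.psi.trace / (h.scale * ((h.dof + 1) / 2)) ∧
      ∀ F : (Fin K → ℝ) → ℝ≥0∞, Measurable F → ∫⁻ x, F x ∂((niw h).map Prod.fst) =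
        κ * ∫⁻ y, F (B *ᵥ y + h.mean) * ENNReal.ofReal
          ((1 + (y ⬝ᵥ y) / ((h.dof + 1) / 2)) ^ (-((h.dof + 1) / 2))) := by
  obtain ⟨κ, hκ⟩ := map_fst_niw h hscale hpsi
  obtain ⟨A, hA, hpsiA⟩ := exists_eq_mul_transpose hpsi
  set p := (h.dof + 1) / 2 with hp
  have hp0 : 0 < p := by rw [hp]; linarith
  -- The scaling is chosen so that `x = b A y + m` turns `λ (x-m)ᵀ Ψ⁻¹ (x-m)` into `|y|²/p`.
  set b := √((h.scale * p)⁻¹) with hb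
  have hb0 : 0 < b := Real.sqrt_pos.2 (by positivity)
  have hbb : b * b = (h.scale * p)⁻¹ := Real.mul_self_sqrt (by positivity)
  have hB : (b • A).det ≠ 0 := by
    rw [Matrix.det_smul]
    exact mul_ne_zero (pow_ne_zero _ hb0.ne') hA
  refine ⟨b • A, κ * ENNReal.ofReal |(b • A).det|, ?_, fun F hF => ?_⟩
  · rw [Matrix.transpose_smul, Matrix.smul_mul, Matrix.mul_smul, smul_smul, hbb, ← hpsiA,
      Matrix.trace_smul, smul_eq_mul, mul_comm, div_eq_mul_inv]
  · have hd : Measurable fun x : Fin K → ℝ => ENNReal.ofReal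
        ((1 + h.scale * ((x - h.mean) ⬝ᵥ (h.psi⁻¹ *ᵥ (x - h.mean)))) ^ (-p)) :=
      ENNReal.measurable_ofReal.comp (((measurable_const.mul
        (measurable_dotProduct_mulVec _ _)).const_add 1).pow_const _)
    have hwd := lintegral_withDensity_eq_lintegral_mul volume
      ((measurable_const (a := κ)).mul hd) hF
    have hsub : ∀ y : Fin K → ℝ, h.scale * (((b • A) *ᵥ y + h.mean - h.mean) ⬝ᵥ
        (h.psi⁻¹ *ᵥ ((b • A) *ᵥ y + h.mean - h.mean))) = (y ⬝ᵥ y) / p := by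
      intro y
      rw [add_sub_cancel_right, Matrix.smul_mulVec, Matrix.mulVec_smul, smul_dotProduct,
        dotProduct_smul, hpsiA, mulVec_dotProduct_inv_mulVec hA, smul_smul, hbb, smul_eq_mul]
      field_simp
    have hm : Measurable fun x => F x * ENNReal.ofReal
        ((1 + h.scale * ((x - h.mean) ⬝ᵥ (h.psi⁻¹ *ᵥ (x - h.mean)))) ^ (-p)) := hF.mul hd
    have hm' := hm.comp (measurable_id.add_const h.mean)
    simp only [Function.comp_def, id] at hm'
    calc _ = κ * ∫⁻ x, F x * ENNReal.ofReal
          ((1 + h.scale * ((x - h.mean) ⬝ᵥ (h.psi⁻¹ *ᵥ (x - h.mean)))) ^ (-p)) := by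
          rw [← lintegral_const_mul _ hm, hκ]
          refine hwd.trans ?_
          refine lintegral_congr fun x => ?_
          simp only [Pi.mul_apply]
          ring
      _ = _ := by
          rw [← lintegral_add_right_eq_self _ h.mean, lintegral_comp_mulVec hB hm', mul_assoc]
          simp_rw [hsub]

lemma exists_niw_concentration (K : ℕ) : ∃ M ν₁ : ℝ, 0 ≤ M ∧ ∀ h : NIWParams K, 0 < h.scale →
    h.psi.PosDef → ν₁ ≤ h.dof → 0 < h.dof ∧ (niw h).map Prod.fst Set.univ = 1 ∧
      ∫⁻ x, ENNReal.ofReal ((x - h.mean) ⬝ᵥ (x - h.mean)) ∂((niw h).map Prod.fst) ≤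
        ENNReal.ofReal (M * (h.psi.trace / (h.scale * h.dof))) := by
  obtain ⟨M₀, hM₀, hM⟩ := exists_lintegral_dotProduct_rpow_le K
  set G := ∫⁻ y : Fin K → ℝ, ENNReal.ofReal (Real.exp (-1 * (y ⬝ᵥ y))) with hG
  have hG0 : G ≠ 0 := lintegral_exp_neg_dotProduct_ne_zero K
  have hMG : M₀ / G ≠ ⊤ := ENNReal.div_ne_top hM₀ hG0
  -- The threshold on the degrees of freedom ensures both `p ≥ K + 2` and a finite normalizing
  -- integral. The factor 2 comes from `p = (ν + 1)/2 ≥ ν/2`.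
  refine ⟨2 * (M₀ / G).toReal, 2 * K + 4 + 2 * Fintype.card (UpperIdx K), by positivity,
    fun h hscale hpsi hdof => ?_⟩
  have hK : (0 : ℝ) ≤ K := Nat.cast_nonneg K
  have hcard : (0 : ℝ) ≤ Fintype.card (UpperIdx K) := Nat.cast_nonneg _
  have hdof0 : 0 < h.dof := by linarith
  have huniv : (niw h).map Prod.fst Set.univ = 1 := by
    rw [Measure.map_apply measurable_fst MeasurableSet.univ, Set.preimage_univ]
    have hpos : ENNReal.ofReal (h.psi.det ^ (-(h.dof / 2))) ≠ 0 := by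
      have := hpsi.det_pos
      rw [Ne, ENNReal.ofReal_eq_zero, not_le]
      positivity
    refine niw_univ h hscale ?_ ?_
    · rw [invWishartMass_eq hpsi]
      exact mul_ne_zero hpos (invWishartMass_one_ne_zero _)
    · rw [invWishartMass_eq hpsi]
      exact ENNReal.mul_ne_top ENNReal.ofReal_ne_top
        (invWishartMass_one_ne_top (by linarith) (by linarith))
  refine ⟨hdof0, huniv, ?_⟩
  obtain ⟨B, κ, htr, hF⟩ := lintegral_map_fst_niw h hscale hpsi hdof0
  set p := (h.dof + 1) / 2 with hp
  -- The unknown constant `κ` is bounded by testing the formula on the constant function 1, whose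
  -- integral is the total mass 1.
  have hκ : κ * G ≤ 1 := by
    have h1 := hF (fun _ => 1) measurable_const
    rw [lintegral_one, huniv] at h1
    rw [h1]
    refine mul_le_mul_right (lintegral_mono fun y => ?_) _
    rw [one_mul]
    exact ENNReal.ofReal_le_ofReal (exp_neg_le_rpow (by linarith)
      ((sq_nonneg _).trans (norm_sq_le_dotProduct y)))
  have hκ' : κ ≤ G⁻¹ := by
    rw [ENNReal.le_inv_iff_mul_le]
    exact hκ
  have hpsitr : 0 ≤ h.psi.trace := hpsi.posSemidef.trace_nonneg
  have hm : Measurable fun x : Fin K → ℝ => ENNReal.ofReal ((x - h.mean) ⬝ᵥ (x - h.mean)) :=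
    ENNReal.measurable_ofReal.comp
      (measurable_dotProduct_self.comp (measurable_id.sub_const h.mean))
  have htr0 : 0 ≤ (B * Bᵀ).trace := by
    rw [htr]
    exact div_nonneg hpsitr (mul_nonneg hscale.le (by linarith))
  rw [hF _ hm]
  have hdm : Measurable fun y : Fin K → ℝ =>
      ENNReal.ofReal (y ⬝ᵥ y) * ENNReal.ofReal ((1 + (y ⬝ᵥ y) / p) ^ (-p)) :=
    (ENNReal.measurable_ofReal.comp measurable_dotProduct_self).mul
      (ENNReal.measurable_ofReal.comp
        (((measurable_dotProduct_self.div_const p).const_add 1).pow_const _))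
  calc _ ≤ G⁻¹ * ∫⁻ y : Fin K → ℝ, ENNReal.ofReal (B * Bᵀ).trace *
        (ENNReal.ofReal (y ⬝ᵥ y) * ENNReal.ofReal ((1 + (y ⬝ᵥ y) / p) ^ (-p))) := by
        refine mul_le_mul' hκ' (lintegral_mono fun y => ?_)
        rw [← mul_assoc, ← ENNReal.ofReal_mul htr0, add_sub_cancel_right]
        exact mul_le_mul_left (ENNReal.ofReal_le_ofReal (mulVec_dotProduct_self_le B y)) _
    _ ≤ G⁻¹ * (ENNReal.ofReal (B * Bᵀ).trace * M₀) := by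
        rw [lintegral_const_mul _ hdm]
        exact mul_le_mul_right (mul_le_mul_right (hM p (by rw [hp]; linarith)) _) _
    _ = ENNReal.ofReal (B * Bᵀ).trace * (M₀ / G) := by
        rw [div_eq_mul_inv]; ring
    _ = ENNReal.ofReal ((B * Bᵀ).trace * (M₀ / G).toReal) := by
        rw [ENNReal.ofReal_mul htr0, ENNReal.ofReal_toReal hMG]
    _ ≤ _ := by
        refine ENNReal.ofReal_le_ofReal ?_
        rw [mul_comm 2, mul_assoc, mul_comm (B * Bᵀ).trace]
        refine mul_le_mul_of_nonneg_left ?_ ENNReal.toReal_nonneg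
        rw [htr, ← mul_div_assoc 2, div_le_div_iff₀ (mul_pos hscale (by linarith))
          (mul_pos hscale hdof0), hp]
        nlinarith [mul_nonneg hpsitr hscale.le]

/-! ### Selection from approximate scores -/

/-- The `p k` and `r k` are within `η` of the values forced by a mean vector that is within `s` of
`μ₀`. -/
structure ApproxScores {K : ℕ} (δ : ℝ) (c : Fin K → ℝ≥0) (μ₀ : Fin K → ℝ) (a s η : ℝ)
    (p r : Fin K → ℝ) : Prop where
  p_nonneg : ∀ k, 0 ≤ p k
  p_le_one : ∀ k, p k ≤ 1
  r_nonneg : ∀ k, 0 ≤ r k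
  r_le_one : ∀ k, r k ≤ 1
  p_small : ∀ k, c k ≠ minComplexity δ c μ₀ → p k ≤ η
  p_large : ∀ k, c k = minComplexity δ c μ₀ → 1 - η ≤ p k
  r_small : ∀ j k, c j = c k → μ₀ j < μ₀ k → r k ≤ Real.exp (-a * (μ₀ k - μ₀ j - 2 * s)) + η
  r_large : ∀ k, (∀ j, c j = c k → μ₀ k ≤ μ₀ j) → (1 - η) * Real.exp (-a * (2 * s)) ≤ r k

lemma exists_pos_le_of_finite {ι : Type*} [Finite ι] (P : ι → Prop) (f : ι → ℝ)
    (hf : ∀ i, P i → 0 < f i) : ∃ γ : ℝ, 0 < γ ∧ ∀ i, P i → γ ≤ f i := by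
  classical
  cases nonempty_fintype ι
  -- The extra element 1 keeps the set nonempty when no index satisfies `P`.
  let s := insert (1 : ℝ) ((Finset.univ.filter P).image f)
  have hs : s.Nonempty := Finset.insert_nonempty _ _
  refine ⟨s.min' hs, ?_, fun i hi => s.min'_le _ (Finset.mem_insert_of_mem
    (Finset.mem_image_of_mem f (Finset.mem_filter.2 ⟨Finset.mem_univ i, hi⟩)))⟩
  have hmem := s.min'_mem hs
  rcases Finset.mem_insert.1 hmem with h | h
  · rw [h]; exact one_pos
  · obtain ⟨i, hi, he⟩ := Finset.mem_image.1 h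
    rw [← he]
    exact hf i (Finset.mem_filter.1 hi).2

lemma selected_eq_targetSet {K : ℕ} (δ : ℝ) (c : Fin K → ℝ≥0) (μ₀ : Fin K → ℝ) {τ : ℝ}
    (hτ : τ ∈ Set.Ioo (0 : ℝ) 1) : ∃ ε ρ η A : ℝ, 0 < ε ∧ 0 < ρ ∧ 0 < η ∧ ∀ a s : ℝ, 0 ≤ a → A ≤ a →
      s ≤ ε → a * s ≤ ρ → ∀ p r : Fin K → ℝ, ApproxScores δ c μ₀ a s η p r →
        selected (fun k => p k * r k) τ = targetSet δ c μ₀ := by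
  obtain ⟨hτ0, hτ1⟩ := hτ
  obtain ⟨γ, hγ0, hγ⟩ := exists_pos_le_of_finite (fun x : Fin K × Fin K => μ₀ x.1 < μ₀ x.2)
    (fun x => μ₀ x.2 - μ₀ x.1) (fun x hx => sub_pos.2 hx)
  -- Here `γ` is a lower bound for the positive gaps of `μ₀`. For `s ≤ γ/4` the exponent is at least
  -- `aγ/2`, and `A` makes the exponential at most `τ/2`; adding `η ≤ τ/2` gives at most `τ`. For
  -- target models, `2as ≤ (1-τ)/4` and `η ≤ (1-τ)/8` give a product of at least `1 - (1-τ)/2 > τ`.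
  refine ⟨γ / 4, (1 - τ) / 8, min (τ / 2) ((1 - τ) / 8), -Real.log (τ / 2) / (γ / 2),
    by linarith, by linarith, lt_min (by linarith) (by linarith), ?_⟩
  intro a s ha0 ha hs has p r h
  set η := min (τ / 2) ((1 - τ) / 8) with hη
  have hη1 : η ≤ τ / 2 := min_le_left _ _
  have hη2 : η ≤ (1 - τ) / 8 := min_le_right _ _
  have hη0 : 0 < η := lt_min (by linarith) (by linarith)
  ext k
  simp only [selected, targetSet, Set.mem_ofPred_eq]
  constructor
  · intro hk
    have hck : c k = minComplexity δ c μ₀ := by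
      by_contra hne
      have h1 := mul_le_mul (h.p_small k hne) (h.r_le_one k) (h.r_nonneg k) hη0.le
      linarith
    refine ⟨hck, fun j hj => ?_⟩
    by_contra hlt
    rw [not_le] at hlt
    have hg := hγ (j, k) hlt
    have h1 := h.r_small j k (hj.trans hck.symm) hlt
    have h2 : Real.exp (-a * (μ₀ k - μ₀ j - 2 * s)) ≤ τ / 2 := by
      rw [← Real.le_log_iff_exp_le (by linarith)]
      rw [div_le_iff₀ (by linarith)] at ha
      simp only at hg
      nlinarith
    have h3 := mul_le_mul (h.p_le_one k) (h1.trans (add_le_add h2 hη1)) (h.r_nonneg k) zero_le_one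
    linarith
  · rintro ⟨hck, hmin⟩
    have h1 := h.p_large k hck
    have h2 := h.r_large k fun j hj => hmin j (hj.trans hck)
    have h3 : 1 - (1 - τ) / 4 ≤ Real.exp (-a * (2 * s)) := by
      have := Real.add_one_le_exp (-a * (2 * s))
      nlinarith
    have h4 : (1 - η) * (1 - (1 - τ) / 4) ≤ r k :=
      (mul_le_mul_of_nonneg_left h3 (by linarith)).trans h2
    have h5 : (1 - η) * ((1 - η) * (1 - (1 - τ) / 4)) ≤ p k * r k :=
      mul_le_mul h1 h4 (mul_nonneg (by linarith) (by linarith)) (h.p_nonneg k)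
    refine lt_of_lt_of_le ?_ h5
    have h6 : 1 - 3 * (1 - τ) / 8 ≤ (1 - η) * (1 - (1 - τ) / 4) := by nlinarith
    nlinarith [mul_le_mul_of_nonneg_left h6 (by linarith : 0 ≤ 1 - η)]

/-! ### Stability of the complexity and of the soft scores under perturbation of the mean -/

lemma abs_iInf_sub_iInf_le {ι : Type*} [Finite ι] [Nonempty ι] {f g : ι → ℝ} {s : ℝ}
    (h : ∀ i, |f i - g i| ≤ s) : |(⨅ i, f i) - ⨅ i, g i| ≤ s := by
  have key : ∀ f g : ι → ℝ, (∀ i, |f i - g i| ≤ s) → (⨅ i, f i) - s ≤ ⨅ i, g i := by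
    intro f g h
    refine le_ciInf fun i => ?_
    have h1 := ciInf_le (Set.finite_range f).bddBelow i
    have h2 := (abs_le.1 (h i)).2
    linarith
  have h1 := key f g h
  have h2 := key g f fun i => by rw [abs_sub_comm]; exact h i
  rw [abs_le]
  constructor <;> linarith

lemma exists_minComplexity_eq {K : ℕ} (hK : 0 < K) {δ : ℝ} (c : Fin K → ℝ≥0) {μ₀ : Fin K → ℝ}
    (hδne : ∀ k, δ ≠ μ₀ k - ⨅ j, μ₀ j) : ∃ ε : ℝ, 0 < ε ∧ ∀ μ : Fin K → ℝ,
      (∀ k, |μ k - μ₀ k| ≤ ε) → minComplexity δ c μ = minComplexity δ c μ₀ := by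
  have : Nonempty (Fin K) := ⟨⟨0, hK⟩⟩
  obtain ⟨γ, hγ0, hγ⟩ := exists_pos_le_of_finite (fun _ : Fin K => True)
    (fun k => |δ - (μ₀ k - ⨅ j, μ₀ j)|) (fun k _ => abs_pos.2 (sub_ne_zero.2 (hδne k)))
  -- Both `μ k` and the minimum move by at most `γ/3`, so no gap moves by `γ` and none crosses `δ`.
  refine ⟨γ / 3, by linarith, fun μ hμ => ?_⟩
  have hset : deltaOptimal δ μ = deltaOptimal δ μ₀ := by
    ext k
    simp only [deltaOptimal, Set.mem_ofPred_eq]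
    have h1 := abs_le.1 (abs_iInf_sub_iInf_le hμ)
    have h2 := abs_le.1 (hμ k)
    rcases le_abs.1 (hγ k trivial) with h3 | h3 <;> constructor <;> intro h4 <;> linarith
  rw [minComplexity, minComplexity, hset]

lemma iInf_class_le {K : ℕ} (c : Fin K → ℝ≥0) (μ : Fin K → ℝ) {j k : Fin K} (h : c j = c k) :
    (⨅ i : {i : Fin K // c i = c k}, μ i) ≤ μ j :=
  ciInf_le (f := fun i : {i : Fin K // c i = c k} => μ i) (Set.finite_range _).bddBelow ⟨j, h⟩

lemma softScore_le_one {K : ℕ} {a : ℝ} (ha : 0 ≤ a) (c : Fin K → ℝ≥0) (k : Fin K)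
    (μ : Fin K → ℝ) : softScore a c k μ ≤ 1 := by
  rw [softScore, Real.exp_le_one_iff]
  have := iInf_class_le c μ (rfl : c k = c k)
  nlinarith

lemma softScore_le {K : ℕ} {a s : ℝ} (ha : 0 ≤ a) {c : Fin K → ℝ≥0} {j k : Fin K} (hc : c j = c k)
    {μ μ₀ : Fin K → ℝ} (hμ : ∀ k, |μ k - μ₀ k| ≤ s) :
    softScore a c k μ ≤ Real.exp (-a * (μ₀ k - μ₀ j - 2 * s)) := by
  rw [softScore, Real.exp_le_exp]
  have h1 := iInf_class_le c μ hc
  have h2 := abs_le.1 (hμ k)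
  have h3 := abs_le.1 (hμ j)
  rw [neg_mul, neg_mul]
  exact neg_le_neg (mul_le_mul_of_nonneg_left (by linarith) ha)

lemma le_softScore {K : ℕ} {a s : ℝ} (ha : 0 ≤ a) {c : Fin K → ℝ≥0} {k : Fin K}
    {μ μ₀ : Fin K → ℝ} (hmin : ∀ j, c j = c k → μ₀ k ≤ μ₀ j) (hμ : ∀ k, |μ k - μ₀ k| ≤ s) :
    Real.exp (-a * (2 * s)) ≤ softScore a c k μ := by
  have : Nonempty {i : Fin K // c i = c k} := ⟨⟨k, rfl⟩⟩
  rw [softScore, Real.exp_le_exp, neg_mul, neg_mul]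
  refine neg_le_neg (mul_le_mul_of_nonneg_left ?_ ha)
  have h1 : μ k - 2 * s ≤ ⨅ i : {i : Fin K // c i = c k}, μ i := by
    refine le_ciInf fun i => ?_
    have h2 := abs_le.1 (hμ k)
    have h3 := abs_le.1 (hμ i)
    have h4 := hmin i i.2
    linarith
  linarith

lemma measurable_softScore {K : ℕ} (a : ℝ) (c : Fin K → ℝ≥0) (k : Fin K) :
    Measurable (softScore a c k) := by
  refine Real.measurable_exp.comp (measurable_const.mul ((measurable_pi_apply k).sub ?_))
  exact Measurable.iInf fun i => measurable_pi_apply _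

/-- Mean vectors within `s` of `μ₀` in every coordinate. -/
def nearSet {K : ℕ} (μ₀ : Fin K → ℝ) (s : ℝ) : Set (Fin K → ℝ) := {μ | ∀ k, |μ k - μ₀ k| ≤ s}

lemma measurableSet_nearSet {K : ℕ} (μ₀ : Fin K → ℝ) (s : ℝ) : MeasurableSet (nearSet μ₀ s) := by
  rw [nearSet, Set.ofPred_forall]
  exact MeasurableSet.iInter fun k => measurableSet_le
    (((measurable_pi_apply k).sub_const _).abs) measurable_const

lemma approxScores_of_measure {K : ℕ} {δ a s η : ℝ} {c : Fin K → ℝ≥0} {μ₀ : Fin K → ℝ}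
    (ha : 0 ≤ a) (hη : 0 ≤ η) (Q : Measure (Fin K → ℝ)) [IsProbabilityMeasure Q]
    (hc : ∀ μ ∈ nearSet μ₀ s, minComplexity δ c μ = minComplexity δ c μ₀)
    (hQ : Q (nearSet μ₀ s)ᶜ ≤ ENNReal.ofReal η) :
    ApproxScores δ c μ₀ a s η (fun k => Q.real {μ | minComplexity δ c μ = c k})
      (fun k => ∫ μ, softScore a c k μ ∂Q) := by
  have hG := measurableSet_nearSet μ₀ s
  have hQr : Q.real (nearSet μ₀ s)ᶜ ≤ η := ENNReal.toReal_le_of_le_ofReal hη hQ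
  have hQG : 1 - η ≤ Q.real (nearSet μ₀ s) := by
    have := probReal_compl_eq_one_sub (μ := Q) hG
    linarith
  have hint : ∀ k, Integrable (softScore a c k) Q := fun k =>
    Integrable.of_bound (measurable_softScore a c k).aestronglyMeasurable 1
      (Eventually.of_forall fun μ => by
        rw [Real.norm_eq_abs, abs_of_pos (show 0 < softScore a c k μ from Real.exp_pos _)]
        exact softScore_le_one ha c k μ)
  refine ⟨fun k => measureReal_nonneg, fun k => measureReal_le_one,
    fun k => integral_nonneg fun μ => (Real.exp_pos _).le, fun k => ?_, fun k hk => ?_,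
    fun k hk => ?_, fun j k hjk hlt => ?_, fun k hmin => ?_⟩
  · refine (integral_mono (hint k) (integrable_const 1) (softScore_le_one ha c k)).trans ?_
    simp
  · refine (measureReal_mono fun μ hμ hmem => ?_).trans hQr
    exact hk (hμ.symm.trans (hc μ hmem))
  · exact hQG.trans (measureReal_mono fun μ hμ => (hc μ hμ).trans hk.symm)
  · set b := Real.exp (-a * (μ₀ k - μ₀ j - 2 * s)) with hb
    have hb0 : 0 < b := Real.exp_pos _
    -- Off the near set the trivial bound 1 applies; that set has mass at most `η`.
    have hle : ∀ μ, softScore a c k μ ≤ b + (nearSet μ₀ s)ᶜ.indicator 1 μ := by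
      intro μ
      by_cases hμ : μ ∈ nearSet μ₀ s
      · rw [Set.indicator_of_notMem (by simpa using hμ), add_zero]
        exact softScore_le ha hjk hμ
      · rw [Set.indicator_of_mem (by simpa using hμ), Pi.one_apply]
        linarith [softScore_le_one ha c k μ]
    have hi : Integrable ((nearSet μ₀ s)ᶜ.indicator (1 : (Fin K → ℝ) → ℝ)) Q :=
      (integrable_const (1 : ℝ)).indicator hG.compl
    refine (integral_mono (hint k) ((integrable_const b).add hi) hle).trans ?_
    simp only [Pi.add_apply]
    rw [integral_add (integrable_const b) hi, integral_indicator_one hG.compl]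
    simpa using hQr
  · set b := Real.exp (-a * (2 * s)) with hb
    have hb0 : 0 < b := Real.exp_pos _
    have hle : ∀ μ, (nearSet μ₀ s).indicator (fun _ => b) μ ≤ softScore a c k μ := by
      intro μ
      by_cases hμ : μ ∈ nearSet μ₀ s
      · rw [Set.indicator_of_mem hμ]
        exact le_softScore ha hmin hμ
      · rw [Set.indicator_of_notMem hμ]
        exact (Real.exp_pos _).le
    refine le_trans ?_ (integral_mono ((integrable_const b).indicator hG) (hint k) hle)
    rw [integral_indicator hG, setIntegral_const, smul_eq_mul]
    exact mul_le_mul_of_nonneg_right hQG hb0.le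

-- When every draw is near `μ₀`, the empirical frequency is exactly 0 or 1, and the average inherits
-- the pointwise bounds on the soft score.
open Classical in
lemma approxScores_of_draws {K T : ℕ} (hT : 0 < T) {δ a s η : ℝ} {c : Fin K → ℝ≥0}
    {μ₀ : Fin K → ℝ} (ha : 0 ≤ a) (hη : 0 ≤ η) (m : Fin T → Fin K → ℝ)
    (hc : ∀ μ ∈ nearSet μ₀ s, minComplexity δ c μ = minComplexity δ c μ₀)
    (hm : ∀ t, m t ∈ nearSet μ₀ s) :
    ApproxScores δ c μ₀ a s η (fun k => (T : ℝ)⁻¹ *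
        ∑ t, if minComplexity δ c (m t) = c k then (1 : ℝ) else 0)
      (fun k => (T : ℝ)⁻¹ * ∑ t, softScore a c k (m t)) := by
  have hT0 : (0 : ℝ) < T := Nat.cast_pos.2 hT
  have hp : ∀ x : ℝ, (T : ℝ)⁻¹ * ∑ _t : Fin T, x = x := fun x => by
    rw [Finset.sum_const, Finset.card_univ, Fintype.card_fin, nsmul_eq_mul,
      inv_mul_cancel_left₀ hT0.ne']
  have hpe : ∀ k, (T : ℝ)⁻¹ * ∑ t, (
      if minComplexity δ c (m t) = c k then (1 : ℝ) else 0) =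
      if minComplexity δ c μ₀ = c k then (1 : ℝ) else 0 := by
    intro k
    rw [← hp (if minComplexity δ c μ₀ = c k then (1 : ℝ) else 0)]
    simp_rw [fun t => hc (m t) (hm t)]
  have hle : ∀ k x, (∀ t, softScore a c k (m t) ≤ x) →
      (T : ℝ)⁻¹ * ∑ t, softScore a c k (m t) ≤ x := fun k x hx => by
    rw [← hp x]
    exact mul_le_mul_of_nonneg_left (Finset.sum_le_sum fun t _ => hx t) (by positivity)
  have hge : ∀ k x, (∀ t, x ≤ softScore a c k (m t)) →
      x ≤ (T : ℝ)⁻¹ * ∑ t, softScore a c k (m t) := fun k x hx => by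
    rw [← hp x]
    exact mul_le_mul_of_nonneg_left (Finset.sum_le_sum fun t _ => hx t) (by positivity)
  refine ⟨fun k => ?_, fun k => ?_, fun k => hge k 0 fun t => (Real.exp_pos _).le,
    fun k => hle k 1 fun t => softScore_le_one ha c k _, fun k hk => ?_,
    fun k hk => ?_, fun j k hjk hlt => ?_, fun k hmin => ?_⟩
  · rw [hpe]; split_ifs <;> norm_num
  · rw [hpe]; split_ifs <;> norm_num
  · rw [hpe, if_neg (Ne.symm hk)]; exact hη
  · rw [hpe, if_pos hk.symm]; linarith
  · exact (hle k _ fun t => softScore_le ha hjk (hm t)).trans (by linarith)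
  · refine le_trans ?_ (hge k _ fun t => le_softScore ha hmin (hm t))
    have := Real.exp_pos (-a * (2 * s))
    nlinarith

/-! ### Stochastic boundedness of sample averages -/

section StochasticBounds

variable {Ω 𝒳 : Type*} [MeasurableSpace Ω] [MeasurableSpace 𝒳] {P : Measure Ω}

lemma IsBigOp.exists_uniform_bound {ι : Type*} [Fintype ι] {Y : ι → ℕ → Ω → ℝ} {a : ι → ℕ → ℝ}
    (ha : ∀ i n, 0 ≤ a i n) (h : ∀ i, IsBigOp P (Y i) (a i)) {ε : ℝ} (hε : 0 < ε) :
    ∃ M : ℝ, 0 ≤ M ∧ ∀ᶠ n in atTop, P {ω | ¬ ∀ i, |Y i n ω| ≤ M * a i n} ≤ ENNReal.ofReal ε := by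
  -- Union bound; the `+ 1` covers an empty index type.
  have hε' : 0 < ε / (Fintype.card ι + 1) := by positivity
  choose M hM using fun i => h i _ hε'
  refine ⟨∑ i, |M i|, by positivity, ?_⟩
  filter_upwards [eventually_all.2 hM] with n hn
  have hsub : {ω | ¬ ∀ i, |Y i n ω| ≤ (∑ i, |M i|) * a i n} ⊆
      ⋃ i ∈ (Finset.univ : Finset ι), {ω | M i * a i n < |Y i n ω|} := by
    intro ω hω
    simp only [Set.mem_ofPred_eq, not_forall, not_le] at hω
    obtain ⟨i, hi⟩ := hω
    refine Set.mem_biUnion (Finset.mem_univ i) (lt_of_le_of_lt ?_ hi)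
    refine mul_le_mul_of_nonneg_right ((le_abs_self _).trans ?_) (ha i n)
    exact Finset.single_le_sum (f := fun i => |M i|) (fun _ _ => abs_nonneg _) (Finset.mem_univ i)
  refine (measure_mono hsub).trans ((measure_biUnion_finset_le _ _).trans ?_)
  refine (Finset.sum_le_sum fun i _ => hn i).trans ?_
  rw [Finset.sum_const, Finset.card_univ, nsmul_eq_mul, ← ENNReal.ofReal_natCast,
    ← ENNReal.ofReal_mul (by positivity)]
  refine ENNReal.ofReal_le_ofReal ?_
  rw [mul_div_assoc', div_le_iff₀ (by positivity)]
  nlinarith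

variable [IsProbabilityMeasure P] {P₀ : Measure 𝒳} {X : ℕ → Ω → 𝒳}

/-- Markov's inequality; only the common mean of the summands enters. -/
lemma isBigOp_average (hXmeas : ∀ i, Measurable (X i)) (hXlaw : ∀ i, P.map (X i) = P₀)
    {f : 𝒳 → ℝ} (hf0 : ∀ x, 0 ≤ f x) (hf : Integrable f P₀) :
    IsBigOp P (fun n ω => (n : ℝ)⁻¹ * ∑ i : Fin n, f (X i ω)) fun _ => 1 := by
  intro ε hε
  have hint : ∀ i, Integrable (fun ω => f (X i ω)) P := fun i => by
    have h := hf
    rw [← hXlaw i] at h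
    exact h.comp_measurable (hXmeas i)
  have hmean : ∀ i, ∫ ω, f (X i ω) ∂P = ∫ x, f x ∂P₀ := fun i => by
    rw [← hXlaw i, integral_map (hXmeas i).aemeasurable]
    rw [hXlaw i]; exact hf.aestronglyMeasurable
  set I := ∫ x, f x ∂P₀ with hI
  have hI0 : 0 ≤ I := integral_nonneg hf0
  refine ⟨(I + 1) / ε, ?_⟩
  filter_upwards [eventually_gt_atTop 0] with n hn
  have hn' : (0 : ℝ) < n := Nat.cast_pos.2 hn
  set A : Ω → ℝ := fun ω => (n : ℝ)⁻¹ * ∑ i : Fin n, f (X i ω) with hA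
  have hA0 : ∀ ω, 0 ≤ A ω := fun ω =>
    mul_nonneg (by positivity) (Finset.sum_nonneg fun i _ => hf0 _)
  have hint' : ∀ i : Fin n, Integrable (fun ω => f (X i ω)) P := fun i => hint i
  have hAint : Integrable A P := (integrable_finsetSum _ fun i _ => hint' i).const_mul _
  have hAmean : ∫ ω, A ω ∂P = I := by
    rw [hA, integral_const_mul, integral_finsetSum _ fun i _ => hint' i]
    simp_rw [hmean]
    rw [Finset.sum_const, Finset.card_univ, Fintype.card_fin, nsmul_eq_mul,
      inv_mul_cancel_left₀ hn'.ne']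
  have hmk := mul_meas_ge_le_integral_of_nonneg (Eventually.of_forall hA0) hAint ((I + 1) / ε)
  rw [hAmean] at hmk
  have hle : P.real {ω | (I + 1) / ε ≤ A ω} ≤ ε := by
    have h1 : (I + 1) * P.real {ω | (I + 1) / ε ≤ A ω} ≤ I * ε := by
      rw [div_mul_eq_mul_div, div_le_iff₀ hε] at hmk
      exact hmk
    have h2 : I * ε ≤ (I + 1) * ε := by nlinarith
    exact le_of_mul_le_mul_left (h1.trans h2) (by linarith)
  refine (measure_mono fun ω hω => ?_).trans
    ((ENNReal.le_ofReal_iff_toReal_le (measure_ne_top _ _) hε.le).2 hle)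
  simp only [Set.mem_ofPred_eq, mul_one] at hω ⊢
  rw [abs_of_nonneg (hA0 ω)] at hω
  exact hω.le

/-- Chebyshev's inequality: by pairwise independence the sum has variance `n V`. -/
lemma isBigOp_average_sub_mean (hXmeas : ∀ i, Measurable (X i)) (hXindep : iIndepFun X P)
    (hXlaw : ∀ i, P.map (X i) = P₀) {f : 𝒳 → ℝ} (hfm : Measurable f) (hf : MemLp f 2 P₀) :
    IsBigOp P (fun n ω => (n : ℝ)⁻¹ * ∑ i : Fin n, f (X i ω) - ∫ x, f x ∂P₀)
      fun n => 1 / Real.sqrt n := by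
  intro ε hε
  have hLp : ∀ i, MemLp (fun ω => f (X i ω)) 2 P := fun i => by
    have h := hf
    rw [← hXlaw i] at h
    exact h.comp_measurePreserving ⟨hXmeas i, rfl⟩
  have hmean : ∀ i, ∫ ω, f (X i ω) ∂P = ∫ x, f x ∂P₀ := fun i => by
    rw [← hXlaw i, integral_map (hXmeas i).aemeasurable hfm.aestronglyMeasurable]
  have hvar : ∀ i, Var[fun ω => f (X i ω); P] = Var[f; P₀] := fun i => by
    rw [← hXlaw i, variance_map hfm.aemeasurable (hXmeas i).aemeasurable]
    rfl
  set I := ∫ x, f x ∂P₀ with hI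
  set V := Var[f; P₀] with hV
  have hV0 : 0 ≤ V := variance_nonneg _ _
  have hMpos : 0 < √((V + 1) / ε) := Real.sqrt_pos.2 (by positivity)
  refine ⟨√((V + 1) / ε), ?_⟩
  filter_upwards [eventually_gt_atTop 0] with n hn
  have hn' : (0 : ℝ) < n := Nat.cast_pos.2 hn
  have hsn : 0 < √(n : ℝ) := Real.sqrt_pos.2 hn'
  set S : Ω → ℝ := ∑ i : Fin n, fun ω => f (X i ω) with hS
  have hLp' : ∀ i : Fin n, MemLp (fun ω => f (X i ω)) 2 P := fun i => hLp i
  have hind : ∀ i j : Fin n, i ≠ j → (fun ω => f (X i ω)) ⟂ᵢ[P] (fun ω => f (X j ω)) :=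
    fun i j hij => (hXindep.indepFun fun h => hij (Fin.ext h)).comp hfm hfm
  have hSLp : MemLp S 2 P := memLp_finsetSum' _ fun i _ => hLp' i
  have hSapp : ∀ ω, S ω = ∑ i : Fin n, f (X i ω) := fun ω => by rw [hS, Finset.sum_apply]
  have hSmean : ∫ ω, S ω ∂P = n * I := by
    simp_rw [hSapp]
    rw [integral_finsetSum _ fun i _ => (hLp' i).integrable one_le_two]
    simp_rw [hmean]
    rw [Finset.sum_const, Finset.card_univ, Fintype.card_fin, nsmul_eq_mul]
  have hSvar : Var[S; P] = n * V := by
    rw [hS, IndepFun.variance_sum (fun i _ => hLp' i) fun i _ j _ hij => hind i j hij]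
    simp_rw [hvar]
    rw [Finset.sum_const, Finset.card_univ, Fintype.card_fin, nsmul_eq_mul]
  have hc : 0 < √((V + 1) / ε) * √(n : ℝ) := mul_pos hMpos hsn
  have hch := meas_ge_le_variance_div_sq hSLp hc
  refine (measure_mono fun ω hω => ?_).trans (hch.trans (ENNReal.ofReal_le_ofReal ?_))
  · simp only [Set.mem_ofPred_eq] at hω ⊢
    rw [hSmean, hSapp]
    have e : (n : ℝ)⁻¹ * ∑ i : Fin n, f (X i ω) - I =
        (∑ i : Fin n, f (X i ω) - n * I) / n := by field_simp
    rw [e, abs_div, abs_of_pos hn', lt_div_iff₀ hn'] at hω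
    refine le_of_eq_of_le ?_ hω.le
    have hs2 : √(n : ℝ) * √(n : ℝ) = n := Real.mul_self_sqrt hn'.le
    field_simp
    rw [sq, hs2]
  · rw [hSvar, mul_pow, Real.sq_sqrt (by positivity), Real.sq_sqrt hn'.le,
      div_le_iff₀ (by positivity)]
    have e : ε * ((V + 1) / ε * n) = (V + 1) * n := by field_simp
    rw [e]
    nlinarith

lemma tendsto_measure_one {A : ℕ → Set Ω}
    (h : ∀ ε : ℝ, 0 < ε → ∀ᶠ n in atTop, P (A n)ᶜ ≤ ENNReal.ofReal ε) :
    Tendsto (fun n => P (A n)) atTop (𝓝 1) := by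
  have h0 : Tendsto (fun n => P (A n)ᶜ) atTop (𝓝 0) := by
    rw [ENNReal.tendsto_nhds_zero]
    intro e he
    by_cases htop : e = ⊤
    · exact Eventually.of_forall fun n => htop ▸ le_top
    · filter_upwards [h e.toReal (ENNReal.toReal_pos he.ne' htop)] with n hn
      rwa [ENNReal.ofReal_toReal htop] at hn
  have h1 : Tendsto (fun n => 1 - P (A n)ᶜ) atTop (𝓝 1) := by
    simpa using ENNReal.Tendsto.sub (tendsto_const_nhds (x := (1 : ℝ≥0∞))) h0
      (Or.inl ENNReal.one_ne_top)
  -- Subadditivity replaces the complement formula, as the events are not assumed measurable.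
  refine tendsto_of_tendsto_of_tendsto_of_le_of_le h1 tendsto_const_nhds (fun n => ?_)
    fun n => prob_le_one
  rw [tsub_le_iff_right, ← measure_univ (μ := P), ← Set.union_compl_self (A n)]
  exact measure_union_le _ _

end StochasticBounds

/-! ### Local Lipschitz bounds for the losses -/

/-- Operator norm at most Frobenius norm: Cauchy–Schwarz over pairs of coordinates. -/
lemma norm_fderiv_fderiv_le_hessianNorm {d : ℕ} (f : EuclideanSpace ℝ (Fin d) → ℝ)
    (θ : EuclideanSpace ℝ (Fin d)) : ‖fderiv ℝ (fderiv ℝ f) θ‖ ≤ hessianNorm f θ := by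
  set B := fderiv ℝ (fderiv ℝ f) θ with hB
  have h0 : 0 ≤ hessianNorm f θ := Real.sqrt_nonneg _
  have hexp : ∀ u : EuclideanSpace ℝ (Fin d), u = ∑ a, u a • EuclideanSpace.single a (1 : ℝ) := by
    intro u
    have h := (EuclideanSpace.basisFun (Fin d) ℝ).sum_repr u
    simpa using h.symm
  refine ContinuousLinearMap.opNorm_le_bound _ h0 fun u => ?_
  refine ContinuousLinearMap.opNorm_le_bound _ (by positivity) fun v => ?_
  have hBuv : B u v = ∑ p : Fin d × Fin d, (u p.1 * v p.2) *
      B (EuclideanSpace.single p.1 1) (EuclideanSpace.single p.2 1) := by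
    conv_lhs => rw [hexp u, hexp v]
    rw [map_sum B, sum_apply, Fintype.sum_prod_type]
    refine Finset.sum_congr rfl fun a _ => ?_
    rw [map_sum]
    refine Finset.sum_congr rfl fun b _ => ?_
    simp only [map_smul, smul_apply, smul_eq_mul]
    ring
  have hcs := Finset.sum_mul_sq_le_sq_mul_sq Finset.univ
    (fun p : Fin d × Fin d => u p.1 * v p.2)
    (fun p => B (EuclideanSpace.single p.1 1) (EuclideanSpace.single p.2 1))
  have huv : ∑ p : Fin d × Fin d, (u p.1 * v p.2) ^ 2 = ‖u‖ ^ 2 * ‖v‖ ^ 2 := by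
    rw [EuclideanSpace.real_norm_sq_eq, EuclideanSpace.real_norm_sq_eq, Finset.sum_mul_sum,
      Fintype.sum_prod_type]
    simp only [mul_pow]
  have hH : ∑ p : Fin d × Fin d,
      B (EuclideanSpace.single p.1 1) (EuclideanSpace.single p.2 1) ^ 2 = hessianNorm f θ ^ 2 := by
    rw [hessianNorm, Real.sq_sqrt (by positivity), Fintype.sum_prod_type]
  rw [← hBuv, huv, hH] at hcs
  rw [Real.norm_eq_abs]
  refine abs_le_of_sq_le_sq ?_ (by positivity)
  calc _ ≤ _ := hcs
    _ = _ := by ring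

/-- The mean value inequality is applied twice: to the derivative, which bounds it on the ball, and
then to `f`. -/
lemma abs_sub_le_of_hessianNorm_le {d : ℕ} {f : EuclideanSpace ℝ (Fin d) → ℝ}
    {θs : EuclideanSpace ℝ (Fin d)} {r H : ℝ} (hr : 0 < r) (hH : 0 ≤ H)
    (hf : ContDiffOn ℝ 2 f (Metric.ball θs r))
    (hbound : ∀ θ ∈ Metric.ball θs r, hessianNorm f θ ≤ H) {θ : EuclideanSpace ℝ (Fin d)}
    (hθ : θ ∈ Metric.ball θs r) :
    |f θ - f θs| ≤ (‖gradient f θs‖ + H * r) * ‖θ - θs‖ := by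
  have hs : θs ∈ Metric.ball θs r := Metric.mem_ball_self hr
  have hat : ∀ x ∈ Metric.ball θs r, ContDiffAt ℝ 2 f x := fun x hx =>
    hf.contDiffAt (Metric.isOpen_ball.mem_nhds hx)
  have hd : ∀ x ∈ Metric.ball θs r, DifferentiableAt ℝ f x := fun x hx =>
    (hat x hx).differentiableAt (by norm_num)
  have hd2 : ∀ x ∈ Metric.ball θs r, DifferentiableAt ℝ (fderiv ℝ f) x := fun x hx =>
    ((hat x hx).fderiv_right (m := 1) (by norm_num)).differentiableAt (by norm_num)
  have hgrad : ‖gradient f θs‖ = ‖fderiv ℝ f θs‖ := by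
    rw [gradient, LinearIsometryEquiv.norm_map]
  have h1 : ∀ x ∈ Metric.ball θs r, ‖fderiv ℝ f x‖ ≤ ‖gradient f θs‖ + H * r := by
    intro x hx
    have h := (convex_ball θs r).norm_image_sub_le_of_norm_fderiv_le hd2
      (fun y hy => (norm_fderiv_fderiv_le_hessianNorm f y).trans (hbound y hy)) hs hx
    have h2 : ‖x - θs‖ ≤ r := by rw [← dist_eq_norm]; exact (Metric.mem_ball.1 hx).le
    have h3 := norm_le_norm_add_norm_sub' (fderiv ℝ f x) (fderiv ℝ f θs)
    rw [hgrad]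
    have h4 := mul_le_mul_of_nonneg_left h2 hH
    linarith
  rw [← Real.norm_eq_abs]
  exact (convex_ball θs r).norm_image_sub_le_of_norm_fderiv_le hd h1 hs hθ

section Regularity

variable {Ω 𝒳 : Type*} [MeasurableSpace Ω] [MeasurableSpace 𝒳] {P : Measure Ω} {X : ℕ → Ω → 𝒳}
  {P₀ : Measure 𝒳} {d : ℕ} {Θ : Set (EuclideanSpace ℝ (Fin d))}
  {ℓ : 𝒳 → EuclideanSpace ℝ (Fin d) → ℝ} {θs : EuclideanSpace ℝ (Fin d)}
  {θhat : ∀ n, (Fin n → 𝒳) → EuclideanSpace ℝ (Fin d)}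

lemma RegularityCondition.exists_lipschitz [IsFiniteMeasure P₀]
    (h : RegularityCondition P X P₀ Θ ℓ θs θhat) :
    ∃ (r : ℝ) (L : 𝒳 → ℝ), 0 < r ∧ (∀ x, 0 ≤ L x) ∧ Integrable L P₀ ∧
      ∀ x θ, ‖θ - θs‖ < r → |ℓ x θ - ℓ x θs| ≤ L x * ‖θ - θs‖ := by
  obtain ⟨r, hr, -, -, hsmooth, H, hH0, hH, hHint⟩ := h.local_smooth
  refine ⟨r, fun x => ‖gradient (ℓ x) θs‖ + H x * r, hr, fun x => ?_, ?_, fun x θ hθ => ?_⟩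
  · have := hH0 x
    positivity
  · exact (h.gradient_memLp.integrable one_le_two).norm.add (hHint.mul_const r)
  · refine abs_sub_le_of_hessianNorm_le hr (hH0 x) (hsmooth x) (hH x) ?_
    rwa [Metric.mem_ball, dist_eq_norm]

lemma RegularityCondition.measurable_loss_optimum (h : RegularityCondition P X P₀ Θ ℓ θs θhat) :
    Measurable fun x => ℓ x θs := by
  obtain ⟨r, hr, hsub, -⟩ := h.local_smooth
  have hmem : θs ∈ Θ := hsub (Metric.mem_ball_self hr)
  exact h.measurable_loss.comp (measurable_id.prodMk (measurable_const (a := (⟨θs, hmem⟩ : Θ))))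

end Regularity

/-! ### Deterministic bounds for the posterior parameters -/

/-- Only the average of the `L i` is controlled, so `∑ L_i²` is bounded by `(∑ L_i)² ≤ (M n)²`. The
lost factor `n` is repaid by the squared rate `M²/n`. -/
lemma average_sq_le {n : ℕ} (hn : 0 < n) {V Z L : Fin n → ℝ} {M : ℝ}
    (hL0 : ∀ i, 0 ≤ L i) (hZ : ∀ i, |Z i - V i| ≤ L i * (M / √n))
    (hL : (n : ℝ)⁻¹ * ∑ i, L i ≤ M) (hV : (n : ℝ)⁻¹ * ∑ i, V i ^ 2 ≤ M) :
    (n : ℝ)⁻¹ * ∑ i, Z i ^ 2 ≤ 2 * M + 2 * M ^ 4 := by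
  have hn' : (0 : ℝ) < n := Nat.cast_pos.2 hn
  have hterm : ∀ i, Z i ^ 2 ≤ 2 * V i ^ 2 + 2 * (M ^ 2 / n) * L i ^ 2 := by
    intro i
    have h1 : (Z i - V i) ^ 2 ≤ (L i * (M / √n)) ^ 2 :=
      sq_le_sq' (abs_le.1 (hZ i)).1 (abs_le.1 (hZ i)).2
    have h2 : (L i * (M / √n)) ^ 2 = (M ^ 2 / n) * L i ^ 2 := by
      rw [mul_pow, div_pow, Real.sq_sqrt hn'.le]; ring
    nlinarith [sq_nonneg (Z i - 2 * V i)]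
  have hsumL : ∑ i, L i ^ 2 ≤ (∑ i, L i) ^ 2 :=
    Finset.sum_sq_le_sq_sum_of_nonneg fun i _ => hL0 i
  have hL' : ∑ i, L i ≤ M * n := by rwa [inv_mul_le_iff₀ hn', mul_comm] at hL
  have hLs : (∑ i, L i) ^ 2 ≤ (M * n) ^ 2 :=
    pow_le_pow_left₀ (Finset.sum_nonneg fun i _ => hL0 i) hL' 2
  have hsum : ∑ i, Z i ^ 2 ≤ 2 * ∑ i, V i ^ 2 + 2 * (M ^ 2 / n) * ∑ i, L i ^ 2 := by
    rw [Finset.mul_sum, Finset.mul_sum, ← Finset.sum_add_distrib]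
    exact Finset.sum_le_sum fun i _ => hterm i
  have h3 : 2 * (M ^ 2 / n) * ∑ i, L i ^ 2 ≤ 2 * M ^ 4 * n := by
    refine (mul_le_mul_of_nonneg_left (hsumL.trans hLs) (by positivity)).trans_eq ?_
    field_simp
  rw [inv_mul_le_iff₀ hn'] at hV ⊢
  linarith

lemma abs_average_sub_le {n : ℕ} (hn : 0 < n) {V Z L : Fin n → ℝ} {M m : ℝ} (hM : 0 ≤ M)
    (hZ : ∀ i, |Z i - V i| ≤ L i * (M / √n))
    (hL : (n : ℝ)⁻¹ * ∑ i, L i ≤ M) (hV : |(n : ℝ)⁻¹ * ∑ i, V i - m| ≤ M * (1 / √n)) :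
    |(n : ℝ)⁻¹ * ∑ i, Z i - m| ≤ (M ^ 2 + M) / √n := by
  have hn' : (0 : ℝ) < n := Nat.cast_pos.2 hn
  have h1 : |(n : ℝ)⁻¹ * ∑ i, Z i - (n : ℝ)⁻¹ * ∑ i, V i| ≤ M * (M / √n) := by
    rw [← mul_sub, ← Finset.sum_sub_distrib, abs_mul, abs_of_pos (inv_pos.2 hn')]
    calc (n : ℝ)⁻¹ * |∑ i, (Z i - V i)| ≤ (n : ℝ)⁻¹ * ∑ i, L i * (M / √n) := by
          refine mul_le_mul_of_nonneg_left ?_ (by positivity)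
          exact (Finset.abs_sum_le_sum_abs _ _).trans (Finset.sum_le_sum fun i _ => hZ i)
      _ = ((n : ℝ)⁻¹ * ∑ i, L i) * (M / √n) := by rw [← Finset.sum_mul]; ring
      _ ≤ _ := mul_le_mul_of_nonneg_right hL (by positivity)
  have h2 := abs_sub_le ((n : ℝ)⁻¹ * ∑ i, Z i) ((n : ℝ)⁻¹ * ∑ i, V i) m
  refine h2.trans ((add_le_add h1 hV).trans_eq ?_)
  ring

lemma sampleMean_apply {K n : ℕ} (z : Fin n → Fin K → ℝ) (k : Fin K) :
    sampleMean z k = (n : ℝ)⁻¹ * ∑ i, z i k := by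
  rw [sampleMean, Pi.smul_apply, Finset.sum_apply, smul_eq_mul]

lemma posSemidef_vecMulVec_self {K : ℕ} (u : Fin K → ℝ) : (Matrix.vecMulVec u u).PosSemidef := by
  simpa using Matrix.posSemidef_vecMulVec_self_star u

lemma NIWParams.Admissible.update_psi_posDef {K n : ℕ} {h : NIWParams K} (hh : h.Admissible)
    (z : Fin n → Fin K → ℝ) : (h.update z).psi.PosDef := by
  have hs := hh.scale_pos
  refine (hh.psi_posDef.add_posSemidef ?_).add_posSemidef ?_
  · refine Matrix.PosSemidef.smul (Matrix.PosSemidef.smul ?_ (by positivity)) (by positivity)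
    exact Matrix.posSemidef_sum _ fun i _ => posSemidef_vecMulVec_self _
  · exact Matrix.PosSemidef.smul (posSemidef_vecMulVec_self _) (by positivity)

lemma trace_sampleCov_le {K n : ℕ} (hn : 0 < n) (z : Fin n → Fin K → ℝ) :
    (sampleCov z).trace ≤ ∑ k, (n : ℝ)⁻¹ * ∑ i, z i k ^ 2 := by
  have hn' : (0 : ℝ) < n := Nat.cast_pos.2 hn
  rw [sampleCov, Matrix.trace_smul, Matrix.trace_sum, smul_eq_mul, ← Finset.mul_sum,
    Finset.sum_comm]
  simp only [Matrix.trace_vecMulVec, dotProduct, Pi.sub_apply]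
  refine mul_le_mul_of_nonneg_left ?_ (by positivity)
  rw [Finset.sum_comm, Finset.sum_comm (f := fun i k => z i k ^ 2)]
  refine Finset.sum_le_sum fun k _ => ?_
  have hmean : ∑ i, z i k = n * sampleMean z k := by
    rw [sampleMean_apply, mul_inv_cancel_left₀ hn'.ne']
  have hexp : ∑ i, (z i k - sampleMean z k) * (z i k - sampleMean z k) =
      ∑ i, z i k ^ 2 - 2 * sampleMean z k * ∑ i, z i k + n * sampleMean z k ^ 2 := by
    rw [Finset.mul_sum, ← Finset.sum_sub_distrib]
    have : (n : ℝ) * sampleMean z k ^ 2 = ∑ _i : Fin n, sampleMean z k ^ 2 := by simp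
    rw [this, ← Finset.sum_add_distrib]
    exact Finset.sum_congr rfl fun i _ => by ring
  rw [hexp, hmean]
  nlinarith [mul_nonneg hn'.le (sq_nonneg (sampleMean z k))]

/-- If the sample moments are close to `μ₀`, so are the posterior parameters. -/
lemma exists_update_bounds {K : ℕ} {h : NIWParams K} (hh : h.Admissible) (μ₀ : Fin K → ℝ)
    (A B : ℝ) (hA : 0 ≤ A) : ∃ C : ℝ, 0 ≤ C ∧ ∀ (n : ℕ) (z : Fin n → Fin K → ℝ), 0 < n →
      (∀ k, |(n : ℝ)⁻¹ * ∑ i, z i k - μ₀ k| ≤ A / √n) →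
      (∀ k, (n : ℝ)⁻¹ * ∑ i, z i k ^ 2 ≤ B) →
      (∀ k, |(h.update z).mean k - μ₀ k| ≤ C / √n) ∧ (h.update z).psi.trace ≤ C * n := by
  have hs := hh.scale_pos
  set D := ∑ k, |h.mean k - μ₀ k| with hD
  have hDk : ∀ k, |h.mean k - μ₀ k| ≤ D := fun k =>
    Finset.single_le_sum (f := fun k => |h.mean k - μ₀ k|) (fun _ _ => abs_nonneg _)
      (Finset.mem_univ k)
  have hD0 : 0 ≤ D := Finset.sum_nonneg fun _ _ => abs_nonneg _
  have hpsi : 0 ≤ h.psi.trace := hh.psi_posDef.posSemidef.trace_nonneg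
  -- The first bracket bounds the centre, as the prior shifts it by at most `λ₀ D / (λ₀ + n) ≤ λ₀ D
  -- / √n`. The second bounds the three terms of `tr Ψ_n`.
  refine ⟨(h.scale * D + A) + (h.psi.trace + K * |B| + h.scale * (K * (A + D) ^ 2)),
    by positivity, fun n z hn hmean hsq => ?_⟩
  have hn' : (0 : ℝ) < n := Nat.cast_pos.2 hn
  have hn1 : (1 : ℝ) ≤ n := by exact_mod_cast hn
  have hsn : 0 < √(n : ℝ) := Real.sqrt_pos.2 hn'
  have hsn1 : 1 ≤ √(n : ℝ) := Real.one_le_sqrt.2 hn1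
  have hss : √(n : ℝ) * √(n : ℝ) = n := Real.mul_self_sqrt hn'.le
  simp_rw [← sampleMean_apply z] at hmean
  constructor
  · intro k
    have e : (h.update z).mean k - μ₀ k =
        (h.scale * (h.mean k - μ₀ k) + n * (sampleMean z k - μ₀ k)) / (h.scale + n) := by
      simp only [NIWParams.update, Pi.smul_apply, Pi.add_apply, smul_eq_mul]
      field_simp
      ring
    rw [e, abs_div, abs_of_pos (show 0 < h.scale + n by positivity), div_le_div_iff₀
      (by positivity) hsn]
    have h1 : |h.scale * (h.mean k - μ₀ k) + n * (sampleMean z k - μ₀ k)| ≤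
        h.scale * D + n * (A / √n) := by
      refine (abs_add_le _ _).trans (add_le_add ?_ ?_)
      · rw [abs_mul, abs_of_pos hs]
        exact mul_le_mul_of_nonneg_left (hDk k) hs.le
      · rw [abs_mul, abs_of_pos hn']
        exact mul_le_mul_of_nonneg_left (hmean k) hn'.le
    have h2 : (h.scale * D + n * (A / √n)) * √n = h.scale * D * √n + A * n := by
      field_simp
    have h3 : √(n : ℝ) ≤ n := by nlinarith
    have h4 : h.scale * D * √n ≤ h.scale * D * n :=
      mul_le_mul_of_nonneg_left h3 (by positivity)
    have h5 := mul_le_mul_of_nonneg_right h1 hsn.le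
    have h6 : 0 ≤ h.psi.trace + K * |B| + h.scale * (K * (A + D) ^ 2) := by positivity
    rw [h2] at h5
    nlinarith [mul_nonneg h6 hn'.le, mul_nonneg h6 hs.le, mul_nonneg (mul_nonneg hs.le hD0) hs.le,
      mul_nonneg hA hs.le]
  · have h1 : (sampleCov z).trace ≤ K * |B| := by
      refine (trace_sampleCov_le hn z).trans ((Finset.sum_le_sum fun k _ =>
        (hsq k).trans (le_abs_self B)).trans_eq ?_)
      simp
    have h2 : (Matrix.vecMulVec (sampleMean z - h.mean) (sampleMean z - h.mean)).trace ≤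
        K * (A + D) ^ 2 := by
      rw [Matrix.trace_vecMulVec, dotProduct]
      have hk : ∀ k, (sampleMean z - h.mean) k * (sampleMean z - h.mean) k ≤ (A + D) ^ 2 := by
        intro k
        rw [← sq, Pi.sub_apply]
        have h3 : |sampleMean z k - h.mean k| ≤ A + D := by
          have h4 := abs_sub_le (sampleMean z k) (μ₀ k) (h.mean k)
          have h5 := hDk k
          rw [abs_sub_comm] at h5
          have h6 : A / √n ≤ A := div_le_self hA hsn1
          linarith [hmean k]
        exact sq_le_sq' (abs_le.1 h3).1 (abs_le.1 h3).2
      refine (Finset.sum_le_sum fun k _ => hk k).trans_eq ?_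
      simp
    have h3 : h.scale * n / (h.scale + n) ≤ h.scale := by
      rw [div_le_iff₀ (by positivity)]
      nlinarith
    have h4 : 0 ≤ (K : ℝ) * (A + D) ^ 2 := by positivity
    have h5 : (h.scale * n / (h.scale + n)) *
        (Matrix.vecMulVec (sampleMean z - h.mean) (sampleMean z - h.mean)).trace ≤
        h.scale * (K * (A + D) ^ 2) :=
      (mul_le_mul_of_nonneg_left h2 (by positivity)).trans (mul_le_mul_of_nonneg_right h3 h4)
    simp only [NIWParams.update, Matrix.trace_add, Matrix.trace_smul, smul_eq_mul]
    have h6 := mul_le_mul_of_nonneg_left h1 hn'.le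
    have h7 : 0 ≤ h.scale * (K * (A + D) ^ 2) := by positivity
    have h8 : 0 ≤ h.scale * D + A := by positivity
    nlinarith

/-! ### Concentration of the posterior at the population means -/

lemma NIWParams.Admissible.dof_nonneg {K : ℕ} (hK : 0 < K) {h : NIWParams K} (hh : h.Admissible) :
    0 ≤ h.dof := by
  have h1 : (1 : ℝ) ≤ K := by exact_mod_cast hK
  linarith [hh.dof_gt]

lemma eventually_lossPosterior_univ {K : ℕ} {h : NIWParams K} (hh : h.Admissible) :
    ∀ᶠ n : ℕ in atTop, ∀ z : Fin n → Fin K → ℝ, lossPosterior h z Set.univ = 1 := by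
  obtain ⟨M, ν₁, -, hconc⟩ := exists_niw_concentration K
  filter_upwards [tendsto_natCast_atTop_atTop.eventually_ge_atTop (ν₁ - h.dof)] with n hn z
  have hs := hh.scale_pos
  refine (hconc (h.update z) ?_ (hh.update_psi_posDef z) ?_).2.1
  · simp only [NIWParams.update]
    positivity
  · simp only [NIWParams.update]
    linarith

lemma compl_nearSet_subset {K : ℕ} {μ₀ m : Fin K → ℝ} {s : ℝ} (hs : 0 < s)
    (hm : ∀ k, |m k - μ₀ k| ≤ s / 2) :
    (nearSet μ₀ s)ᶜ ⊆ {x | ENNReal.ofReal ((s / 2) ^ 2) ≤ ENNReal.ofReal ((x - m) ⬝ᵥ (x - m))} := by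
  intro x hx
  simp only [nearSet, Set.mem_compl_iff, Set.mem_ofPred_eq, not_forall, not_le] at hx
  obtain ⟨k, hk⟩ := hx
  refine ENNReal.ofReal_le_ofReal ?_
  have h1 : s / 2 ≤ |x k - m k| := by
    have h2 := abs_sub_le (x k) (m k) (μ₀ k)
    linarith [hm k]
  calc (s / 2) ^ 2 ≤ |x k - m k| ^ 2 := pow_le_pow_left₀ (by linarith) h1 2
    _ = (x - m) k * (x - m) k := by rw [sq_abs, Pi.sub_apply, sq]
    _ ≤ (x - m) ⬝ᵥ (x - m) :=
      Finset.single_le_sum (f := fun k => (x - m) k * (x - m) k) (fun _ _ => mul_self_nonneg _)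
        (Finset.mem_univ k)

/-- Markov's inequality for the squared distance to the posterior centre, whose expectation is
`O(1/n)` while `n s_n² → ∞`. The threshold on `n` is uniform over all data sets satisfying the
moment bounds. -/
lemma eventually_lossPosterior_compl_nearSet_le {K : ℕ} (hK : 0 < K) {h : NIWParams K}
    (hh : h.Admissible) (μ₀ : Fin K → ℝ) {A : ℝ} (hA : 0 ≤ A) (B : ℝ) {s : ℕ → ℝ}
    (hs : Tendsto (fun n : ℕ => √(n : ℝ) * s n) atTop atTop) {η : ℝ} (hη : 0 < η) :
    ∀ᶠ n : ℕ in atTop, ∀ z : Fin n → Fin K → ℝ,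
      (∀ k, |(n : ℝ)⁻¹ * ∑ i, z i k - μ₀ k| ≤ A / √n) →
      (∀ k, (n : ℝ)⁻¹ * ∑ i, z i k ^ 2 ≤ B) →
      lossPosterior h z (nearSet μ₀ (s n))ᶜ ≤ ENNReal.ofReal η := by
  obtain ⟨M, ν₁, hM, hconc⟩ := exists_niw_concentration K
  obtain ⟨C, hC, hup⟩ := exists_update_bounds hh μ₀ A B hA
  have hsc := hh.scale_pos
  have hdof := hh.dof_nonneg hK
  filter_upwards [tendsto_natCast_atTop_atTop.eventually_ge_atTop (ν₁ - h.dof),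
    -- The bound `2C` puts the posterior centre within `s n / 2` of `μ₀`. In the other bound, the
    -- summand 1 gives `√n s ≤ n s²`, and the rest then gives `MC/n ≤ (s/2)² η`.
    eventually_gt_atTop 0, hs.eventually_ge_atTop (2 * C),
    hs.eventually_ge_atTop (1 + 4 * (M * C) / η)] with n hn hn0 hs1 hs2 z hz1 hz2
  have hn' : (0 : ℝ) < n := Nat.cast_pos.2 hn0
  have hsn : 0 < √(n : ℝ) := Real.sqrt_pos.2 hn'
  have hMC : 0 ≤ 4 * (M * C) / η := by positivity
  have hspos : 0 < s n := by
    by_contra hneg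
    have := mul_nonpos_of_nonneg_of_nonpos hsn.le (not_lt.1 hneg)
    linarith
  obtain ⟨hmean, htr⟩ := hup n z hn0 hz1 hz2
  have hscale : 0 < (h.update z).scale := by
    simp only [NIWParams.update]; positivity
  have hpsi := hh.update_psi_posDef z
  obtain ⟨hd0, -, hE⟩ := hconc (h.update z) hscale hpsi (by
    simp only [NIWParams.update]; linarith)
  have hmean' : ∀ k, |(h.update z).mean k - μ₀ k| ≤ s n / 2 := fun k => by
    refine (hmean k).trans ?_
    rw [div_le_iff₀ hsn]
    linarith
  have hmeas : Measurable fun x : Fin K → ℝ =>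
      ENNReal.ofReal ((x - (h.update z).mean) ⬝ᵥ (x - (h.update z).mean)) :=
    ENNReal.measurable_ofReal.comp (measurable_dotProduct_self.comp (measurable_id.sub_const _))
  have hmk := mul_meas_ge_le_lintegral (μ := lossPosterior h z) hmeas
    (ENNReal.ofReal ((s n / 2) ^ 2))
  have hsq : 0 < (s n / 2) ^ 2 := by positivity
  have hbound : M * ((h.update z).psi.trace / ((h.update z).scale * (h.update z).dof)) ≤
      (s n / 2) ^ 2 * η := by
    have h1 : (h.update z).psi.trace / ((h.update z).scale * (h.update z).dof) ≤ C / n := by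
      have hsd : (n : ℝ) * n ≤ (h.update z).scale * (h.update z).dof := by
        simp only [NIWParams.update]
        exact mul_le_mul (by linarith) (by linarith) hn'.le (by linarith)
      rw [div_le_div_iff₀ (mul_pos hscale hd0) hn']
      have h2 := mul_le_mul_of_nonneg_right htr hn'.le
      have h3 := mul_le_mul_of_nonneg_left hsd hC
      linarith
    have h4 : 4 * (M * C) / η ≤ n * s n ^ 2 := by
      have h5 : √(n : ℝ) * s n ≤ (√(n : ℝ) * s n) ^ 2 := by nlinarith
      rw [mul_pow, Real.sq_sqrt hn'.le] at h5
      linarith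
    rw [div_le_iff₀ hη] at h4
    refine (mul_le_mul_of_nonneg_left h1 hM).trans ?_
    rw [← mul_div_assoc, div_le_iff₀ hn']
    linarith
  have hfin : ENNReal.ofReal ((s n / 2) ^ 2) * lossPosterior h z (nearSet μ₀ (s n))ᶜ ≤
      ENNReal.ofReal ((s n / 2) ^ 2) * ENNReal.ofReal η := by
    rw [← ENNReal.ofReal_mul hsq.le]
    exact (mul_le_mul_right (measure_mono (compl_nearSet_subset hspos hmean')) _).trans
      (hmk.trans (hE.trans (ENNReal.ofReal_le_ofReal hbound)))
  exact (ENNReal.mul_le_mul_iff_right (ENNReal.ofReal_pos.2 hsq).ne' ENNReal.ofReal_ne_top).1 hfin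

/-! ### From random data to posterior concentration in probability -/

section Main

variable {Ω 𝒳 : Type*} [MeasurableSpace Ω] [MeasurableSpace 𝒳]
  {P : Measure Ω} [IsProbabilityMeasure P] {P₀ : Measure 𝒳} [IsProbabilityMeasure P₀]
  {X : ℕ → Ω → 𝒳} {K : ℕ} {d : Fin K → ℕ} {Θ : ∀ k, Set (EuclideanSpace ℝ (Fin (d k)))}
  {ℓ : ∀ k, 𝒳 → EuclideanSpace ℝ (Fin (d k)) → ℝ} {θs : ∀ k, EuclideanSpace ℝ (Fin (d k))}
  {θhat : ∀ k n, (Fin n → 𝒳) → EuclideanSpace ℝ (Fin (d k))}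

lemma exists_sample_moment_bounds (hXmeas : ∀ i, Measurable (X i))
    (hXindep : iIndepFun X P) (hXlaw : ∀ i, P.map (X i) = P₀) (hmom : MomentCondition P₀ ℓ θs)
    (hreg : ∀ k, RegularityCondition P X P₀ (Θ k) (ℓ k) (θs k) (θhat k)) {ε : ℝ} (hε : 0 < ε) :
    ∃ A B : ℝ, 0 ≤ A ∧ ∀ᶠ n : ℕ in atTop, P {ω | ¬
      ((∀ k, |(n : ℝ)⁻¹ * ∑ i, ladData ℓ (fun k => θhat k n) (firstObs X n ω) i k -
          popMean P₀ ℓ θs k| ≤ A / √n) ∧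
        ∀ k, (n : ℝ)⁻¹ * ∑ i, ladData ℓ (fun k => θhat k n) (firstObs X n ω) i k ^ 2 ≤ B)} ≤
      ENNReal.ofReal ε := by
  choose r L hr hL0 hLint hL using fun k => (hreg k).exists_lipschitz
  have b1 : ∀ k, IsBigOp P (fun n ω => ‖θhat k n (firstObs X n ω) - θs k‖) fun n => 1 / √n :=
    fun k => (hreg k).estimator_rate
  have b2 : ∀ k, IsBigOp P (fun n ω => (n : ℝ)⁻¹ * ∑ i : Fin n, L k (X i ω)) fun _ => 1 :=
    fun k => isBigOp_average hXmeas hXlaw (hL0 k) (hLint k)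
  have b3 : ∀ k, IsBigOp P (fun n ω => (n : ℝ)⁻¹ * ∑ i : Fin n, ℓ k (X i ω) (θs k) -
      popMean P₀ ℓ θs k) fun n => 1 / √n := fun k =>
    isBigOp_average_sub_mean (f := fun x => ℓ k x (θs k)) hXmeas hXindep hXlaw
      (hreg k).measurable_loss_optimum (hmom.memLp k)
  have b4 : ∀ k, IsBigOp P (fun n ω => (n : ℝ)⁻¹ * ∑ i : Fin n, ℓ k (X i ω) (θs k) ^ 2)
      fun _ => 1 := fun k =>
    isBigOp_average (f := fun x => ℓ k x (θs k) ^ 2) hXmeas hXlaw (fun x => sq_nonneg _)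
      (hmom.memLp k).integrable_sq
  -- The four families of estimates are indexed by one finite type, so that a single constant `M`
  -- and a single exceptional event serve them all.
  let Y : Fin K ⊕ Fin K ⊕ Fin K ⊕ Fin K → ℕ → Ω → ℝ :=
    Sum.elim (fun k n ω => ‖θhat k n (firstObs X n ω) - θs k‖)
      (Sum.elim (fun k n ω => (n : ℝ)⁻¹ * ∑ i : Fin n, L k (X i ω))
        (Sum.elim (fun k n ω => (n : ℝ)⁻¹ * ∑ i : Fin n, ℓ k (X i ω) (θs k) - popMean P₀ ℓ θs k)
          fun k n ω => (n : ℝ)⁻¹ * ∑ i : Fin n, ℓ k (X i ω) (θs k) ^ 2))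
  let a : Fin K ⊕ Fin K ⊕ Fin K ⊕ Fin K → ℕ → ℝ :=
    Sum.elim (fun _ n => 1 / √n)
      (Sum.elim (fun _ _ => 1) (Sum.elim (fun _ n => 1 / √n) fun _ _ => 1))
  have ha : ∀ i n, 0 ≤ a i n := by
    rintro (k | k | k | k) n <;> simp only [a, Sum.elim_inl, Sum.elim_inr] <;> positivity
  have hY : ∀ i, IsBigOp P (Y i) (a i) := by
    rintro (k | k | k | k)
    · exact b1 k
    · exact b2 k
    · exact b3 k
    · exact b4 k
  obtain ⟨M, hM, hev⟩ := IsBigOp.exists_uniform_bound ha hY hε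
  refine ⟨M ^ 2 + M, 2 * M + 2 * M ^ 4, by positivity, ?_⟩
  have hsqrt : Tendsto (fun n : ℕ => √(n : ℝ)) atTop atTop :=
    Real.tendsto_sqrt_atTop.comp tendsto_natCast_atTop_atTop
  -- Off the exceptional event the estimators eventually lie in the balls where the Lipschitz bounds
  -- hold.
  have hball : ∀ᶠ n : ℕ in atTop, ∀ k, M / √n < r k := eventually_all.2 fun k =>
    (hsqrt.const_div_atTop M).eventually_lt_const (hr k)
  filter_upwards [hev, hball, eventually_gt_atTop 0] with n hn hrn hn0
  refine (measure_mono fun ω hω => ?_).trans hn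
  simp only [Set.mem_ofPred_eq] at hω ⊢
  contrapose! hω
  have h1 : ∀ k, ‖θhat k n (firstObs X n ω) - θs k‖ ≤ M / √n := fun k => by
    have h := hω (Sum.inl k)
    simp only [Y, a, Sum.elim_inl, abs_norm] at h
    rwa [mul_one_div] at h
  have h2 : ∀ k, (n : ℝ)⁻¹ * ∑ i : Fin n, L k (X i ω) ≤ M := fun k => by
    have h := hω (Sum.inr (Sum.inl k))
    simp only [Y, a, Sum.elim_inl, Sum.elim_inr, mul_one] at h
    exact (le_abs_self _).trans h
  have h3 : ∀ k, |(n : ℝ)⁻¹ * ∑ i : Fin n, ℓ k (X i ω) (θs k) - popMean P₀ ℓ θs k| ≤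
      M * (1 / √n) := fun k => hω (Sum.inr (Sum.inr (Sum.inl k)))
  have h4 : ∀ k, (n : ℝ)⁻¹ * ∑ i : Fin n, ℓ k (X i ω) (θs k) ^ 2 ≤ M := fun k => by
    have h := hω (Sum.inr (Sum.inr (Sum.inr k)))
    simp only [Y, a, Sum.elim_inr, mul_one] at h
    exact (le_abs_self _).trans h
  have hZ : ∀ k (i : Fin n), |ladData ℓ (fun k => θhat k n) (firstObs X n ω) i k -
      ℓ k (X i ω) (θs k)| ≤ L k (X i ω) * (M / √n) := fun k i =>
    (hL k (X i ω) _ ((h1 k).trans_lt (hrn k))).trans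
      (mul_le_mul_of_nonneg_left (h1 k) (hL0 k _))
  exact ⟨fun k => abs_average_sub_le hn0 hM (hZ k) (h2 k) (h3 k),
    fun k => average_sq_le hn0 (fun i => hL0 k _) (hZ k) (h2 k) (h4 k)⟩

lemma eventually_measure_lossPosterior_le (hXmeas : ∀ i, Measurable (X i))
    (hXindep : iIndepFun X P) (hXlaw : ∀ i, P.map (X i) = P₀) (hK : 0 < K)
    (hmom : MomentCondition P₀ ℓ θs)
    (hreg : ∀ k, RegularityCondition P X P₀ (Θ k) (ℓ k) (θs k) (θhat k))
    {h : NIWParams K} (hh : h.Admissible) {s : ℕ → ℝ}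
    (hs : Tendsto (fun n : ℕ => √(n : ℝ) * s n) atTop atTop) {η ε : ℝ} (hη : 0 < η) (hε : 0 < ε) :
    ∀ᶠ n : ℕ in atTop, P {ω | ¬ lossPosterior h (ladData ℓ (fun k => θhat k n) (firstObs X n ω))
      (nearSet (popMean P₀ ℓ θs) (s n))ᶜ ≤ ENNReal.ofReal η} ≤ ENNReal.ofReal ε := by
  obtain ⟨A, B, hA, hev⟩ := exists_sample_moment_bounds hXmeas hXindep hXlaw hmom hreg hε
  filter_upwards [hev, eventually_lossPosterior_compl_nearSet_le hK hh (popMean P₀ ℓ θs) hA B hs hη]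
    with n hn hpost
  refine (measure_mono fun ω hω => ?_).trans hn
  exact fun hc => hω (hpost _ hc.1 hc.2)

/-- The probability is the expectation of the posterior mass of `B`, which is at most `η` off the
bad event and at most 1 on it. -/
lemma IsPosteriorDraw.measure_le {n : ℕ} {h : NIWParams K} {Z : Ω → Fin n → Fin K → ℝ}
    {m : Ω → Fin K → ℝ} (hm : IsPosteriorDraw P h Z m)
    (huniv : ∀ z : Fin n → Fin K → ℝ, lossPosterior h z Set.univ = 1) {B : Set (Fin K → ℝ)}
    (hB : MeasurableSet B) (η : ℝ≥0∞) :
    P (m ⁻¹' B) ≤ η + P {ω | ¬ lossPosterior h (Z ω) B ≤ η} := by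
  have h1 := hm.2 Set.univ MeasurableSet.univ B hB
  rw [Set.preimage_univ, Set.univ_inter, Measure.restrict_univ] at h1
  rw [h1]
  set bad := {ω | ¬ lossPosterior h (Z ω) B ≤ η} with hbad
  -- The bad event need not be measurable; its measurable hull has the same probability.
  have hle : ∀ ω, lossPosterior h (Z ω) B ≤ η + (toMeasurable P bad).indicator 1 ω := by
    intro ω
    by_cases hω : lossPosterior h (Z ω) B ≤ η
    · exact hω.trans le_self_add
    · rw [Set.indicator_of_mem (subset_toMeasurable P bad hω), Pi.one_apply]
      refine (measure_mono (Set.subset_univ B)).trans ?_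
      rw [huniv]
      exact le_add_self
  refine (lintegral_mono hle).trans ?_
  rw [lintegral_add_left measurable_const, lintegral_const, measure_univ, mul_one,
    lintegral_indicator_one (measurableSet_toMeasurable P bad), measure_toMeasurable]

end Main

/-! ### Choice of the radii, and the selection theorem -/

lemma exists_radius_sequence {α : ℕ → ℝ} (hα0 : ∀ n, 0 ≤ α n)
    (hαo : α =o[atTop] fun n : ℕ => Real.sqrt n) {ε ρ : ℝ} (hε : 0 < ε) (hρ : 0 < ρ) :
    ∃ s : ℕ → ℝ, (∀ n, s n ≤ ε) ∧ (∀ n, α n * s n ≤ ρ) ∧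
      Tendsto (fun n : ℕ => √(n : ℝ) * s n) atTop atTop := by
  have hsqrt : Tendsto (fun n : ℕ => √(n : ℝ)) atTop atTop :=
    Real.tendsto_sqrt_atTop.comp tendsto_natCast_atTop_atTop
  -- The `+ 1` keeps the quotient meaningful at `α n = 0`; `√n / (α n + 1)` still diverges because
  -- `α = o(√n)`.
  refine ⟨fun n => min ε (ρ / (α n + 1)), fun n => min_le_left _ _, fun n => ?_, ?_⟩
  · have h1 : 0 < α n + 1 := by linarith [hα0 n]
    refine (mul_le_mul_of_nonneg_left (min_le_right _ _) (hα0 n)).trans ?_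
    rw [mul_div_assoc', div_le_iff₀ h1]
    nlinarith
  · refine tendsto_atTop.2 fun b => ?_
    have hb : 0 < ρ / (2 * (|b| + 1)) := by positivity
    filter_upwards [hαo.bound hb, hsqrt.eventually_ge_atTop (|b| / ε),
      hsqrt.eventually_ge_atTop (2 * |b| / ρ)] with n h1 h2 h3
    have hα1 : 0 < α n + 1 := by linarith [hα0 n]
    rw [Real.norm_eq_abs, Real.norm_eq_abs, abs_of_nonneg (hα0 n),
      abs_of_nonneg (Real.sqrt_nonneg _)] at h1
    rw [div_le_iff₀ hε] at h2
    rw [div_le_iff₀ hρ] at h3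
    refine (le_abs_self b).trans ?_
    rcases min_choice ε (ρ / (α n + 1)) with h | h <;> rw [h]
    · exact h2
    · rw [mul_div_assoc', le_div_iff₀ hα1]
      have h4 : |b| * α n ≤ √(n : ℝ) * ρ / 2 := by
        rw [div_mul_eq_mul_div, le_div_iff₀ (by positivity)] at h1
        nlinarith [hα0 n]
      linarith

end LaD

theorem mainTheorem3 {Ω 𝒳 : Type*} [MeasurableSpace Ω] [MeasurableSpace 𝒳]
    (P : Measure Ω) [IsProbabilityMeasure P]
    -- i.i.d. observations from P₀
    (P₀ : Measure 𝒳) [IsProbabilityMeasure P₀]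
    (X : ℕ → Ω → 𝒳) (hXmeas : ∀ i, Measurable (X i))
    (hXindep : iIndepFun X P) (hXlaw : ∀ i, P.map (X i) = P₀)
    -- K parametric models with losses, complexities, optimal parameters and estimators
    (K : ℕ) (hK : 0 < K) (c : Fin K → ℝ≥0) (d : Fin K → ℕ)
    (Θ : ∀ k, Set (EuclideanSpace ℝ (Fin (d k))))
    (ℓ : ∀ k, 𝒳 → EuclideanSpace ℝ (Fin (d k)) → ℝ)
    (θs : ∀ k, EuclideanSpace ℝ (Fin (d k)))
    (θhat : ∀ k n, (Fin n → 𝒳) → EuclideanSpace ℝ (Fin (d k)))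
    (hmom : MomentCondition P₀ ℓ θs)
    (hreg : ∀ k, RegularityCondition P X P₀ (Θ k) (ℓ k) (θs k) (θhat k))
    -- tolerance, temperatures, prior and threshold
    (δ : ℝ) (hδ : 0 < δ)
    (hδne : ∀ k, δ ≠ popMean P₀ ℓ θs k - ⨅ j, popMean P₀ ℓ θs j)
    (α : ℕ → ℝ) (hα0 : ∀ n, 0 ≤ α n) (hαtop : Tendsto α atTop atTop)
    (hαo : α =o[atTop] fun n : ℕ => Real.sqrt n)
    (h : NIWParams K) (hh : h.Admissible)
    (τ : ℝ) (hτ : τ ∈ Set.Ioo (0 : ℝ) 1) :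
    -- exact scores
    Tendsto (fun n : ℕ => P {ω |
        selected (slcScore h δ (α n) c
          (ladData ℓ (fun k => θhat k n) (firstObs X n ω))) τ =
        targetSet δ c (popMean P₀ ℓ θs)}) atTop (𝓝 1) ∧
    -- Monte Carlo scores from T posterior draws
    ∀ (T : ℕ), 0 < T → ∀ m : ∀ (_ : ℕ), Fin T → Ω → Fin K → ℝ,
      (∀ n t, IsPosteriorDraw P h
        (fun ω => ladData ℓ (fun k => θhat k n) (firstObs X n ω)) (m n t)) →
      Tendsto (fun n : ℕ => P {ω |
        selected (slcScoreMC δ (α n) c (fun t => m n t ω)) τ =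
        targetSet δ c (popMean P₀ ℓ θs)}) atTop (𝓝 1) := by
  obtain ⟨ε₁, hε₁, hcomp⟩ := exists_minComplexity_eq hK c hδne
  obtain ⟨ε₂, ρ, η, A, hε₂, hρ, hη, hsel⟩ := selected_eq_targetSet δ c (popMean P₀ ℓ θs) hτ
  obtain ⟨s, hsε, hsρ, hs⟩ := exists_radius_sequence hα0 hαo (lt_min hε₁ hε₂) hρ
  have hc : ∀ n, ∀ μ ∈ nearSet (popMean P₀ ℓ θs) (s n),
      minComplexity δ c μ = minComplexity δ c (popMean P₀ ℓ θs) := fun n μ hμ =>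
    hcomp μ fun k => (hμ k).trans ((hsε n).trans (min_le_left _ _))
  have hsel' : ∀ n, A ≤ α n → ∀ p r : Fin K → ℝ,
      ApproxScores δ c (popMean P₀ ℓ θs) (α n) (s n) η p r →
      selected (fun k => p k * r k) τ = targetSet δ c (popMean P₀ ℓ θs) := fun n hA =>
    hsel (α n) (s n) (hα0 n) hA ((hsε n).trans (min_le_right _ _)) (hsρ n)
  constructor
  · refine tendsto_measure_one fun e he => ?_
    filter_upwards [eventually_measure_lossPosterior_le hXmeas hXindep hXlaw hK hmom hreg hh hs hη
      he, eventually_lossPosterior_univ hh, hαtop.eventually_ge_atTop A] with n hn huniv hA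
    refine (measure_mono fun ω hω => ?_).trans hn
    refine fun hQ => hω ?_
    have : IsProbabilityMeasure
        (lossPosterior h (ladData ℓ (fun k => θhat k n) (firstObs X n ω))) := ⟨huniv _⟩
    exact hsel' n hA _ _ (approxScores_of_measure (hα0 n) hη.le _ (hc n) hQ)
  · intro T hT m hm
    refine tendsto_measure_one fun e he => ?_
    have hT0 : (0 : ℝ) < T := Nat.cast_pos.2 hT
    -- Each draw may fail with probability `e/T`: half for the posterior mass outside the near set,
    -- half for the data event where that mass is not small.
    have he' : 0 < e / (2 * T) := by positivity
    filter_upwards [eventually_measure_lossPosterior_le hXmeas hXindep hXlaw hK hmom hreg hh hs he'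
      he', eventually_lossPosterior_univ hh, hαtop.eventually_ge_atTop A] with n hn huniv hA
    have hsub : {ω | selected (slcScoreMC δ (α n) c (fun t => m n t ω)) τ =
        targetSet δ c (popMean P₀ ℓ θs)}ᶜ ⊆ ⋃ t ∈ (Finset.univ : Finset (Fin T)),
          m n t ⁻¹' (nearSet (popMean P₀ ℓ θs) (s n))ᶜ := by
      intro ω hω
      by_contra hcon
      refine hω (hsel' n hA _ _ (approxScores_of_draws hT (hα0 n) hη.le _ (hc n) fun t => ?_))
      by_contra ht
      exact hcon (Set.mem_biUnion (Finset.mem_univ t) ht)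
    refine (measure_mono hsub).trans ((measure_biUnion_finset_le _ _).trans ?_)
    have hterm : ∀ t, P (m n t ⁻¹' (nearSet (popMean P₀ ℓ θs) (s n))ᶜ) ≤ ENNReal.ofReal (e / T) := by
      intro t
      refine ((hm n t).measure_le huniv (measurableSet_nearSet _ _).compl _).trans
        ((add_le_add_right hn _).trans_eq ?_)
      rw [← ENNReal.ofReal_add he'.le he'.le]
      congr 1
      field_simp
      ring
    refine (Finset.sum_le_sum fun t _ => hterm t).trans_eq ?_
    rw [Finset.sum_const, Finset.card_univ, Fintype.card_fin, nsmul_eq_mul,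
      ← ENNReal.ofReal_natCast, ← ENNReal.ofReal_mul hT0.le]
    congr 1
    field_simp
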